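/- **Setting.** Let $K\ge 2$, $p\ge 1$ and $N>K$. Let $(X_1,Y_1),\dots,(X_N,Y_N)$ be i.i.d. pairs with $Y_i\in\{1,\dots,K\}$, $\mathbb P(Y_i=k)=\pi_k>0$ and $X_i\mid Y_i=k\sim\mathcal N(\mu_k,\Sigma)$ in $\mathbb R^p$, where $\Sigma$ is positive definite. Put $K'=K-1$ and, for $1\le k\le K'$, $\delta_k=\mu_1-\mu_{k+1}$, $\beta_k=\Sigma^{-1}\delta_k=(\beta_k^1,\dots,\beta_k^p)$ and $T_k=\mathrm{Supp}(\beta_k)$. Let $s=\mathrm{card}\big(\bigcup_k T_k\big)$, $\Delta=\sum_{k=1}^{K'}\langle\Sigma^{-1}\delta_k,\delta_k\rangle$ and $\bar\pi=\max_{2\le k\le K}\frac{\pi_1+\pi_k}{\pi_1\pi_k}$. Write $\Sigma^+_{\min}=\min_j\Sigma_{jj}$, $\Sigma^+_{\max}=\max_j\Sigma_{jj}$, $\Sigma^-_{\max}=\max_{i\ne j}|\Sigma_{ij}|$ (which is $0$ if $p=1$). Let $n_k=\#\{i:Y_i=k\}$, $\hat\mu_k=n_k^{-1}\sum_{Y_i=k}X_i$,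 $\hat\delta_k=\hat\mu_1-\hat\mu_{k+1}$ and $S=(N-K)^{-1}\sum_{k=1}^K\sum_{Y_i=k}(X_i-\hat\mu_k)(X_i-\hat\mu_k)'$. The group-LASSO LDA estimator $(\hat\beta_1,\dots,\hat\beta_{K'})$ with parameter $\lambda>0$ is a solution of $$\min_{b_1,\dots,b_{K'}\in\mathbb R^p}\ \sum_{k=1}^{K'}\tfrac12 b_k'Sb_k-\sum_{k=1}^{K'}\hat\delta_k'b_k+\lambda\sum_{j=1}^p\|(b_1^j,\dots,b_{K'}^j)\|_2 .$$ For $\zeta>0$ let $\phi_\zeta(x)=x$ if $|x|\ge\zeta$ and $\phi_\zeta(x)=0$ if $|x|<\zeta$, applied to vectors entry by entry. **Theorem 1.** There are universal constants $C_0,C_1,C_3>0$ such that, with $C_2=4+\sqrt{C_1}/8$, the following holds in every such setting. Let $$\lambda=2C_0\sqrt{\frac{\bar\pi\,\Sigma^+_{\max}(\Delta\vee K)\,t}{N-K}}\quad\text{with } t=4\log(p\vee N),$$ and suppose that $\Sigma^+_{\min}\ge 128\,s\,\Sigma^-_{\max}$ and $N\ge K+C_3\big(\Sigma^+_{\max}/\Sigma^+_{\min}\big)^2s^2\log(p\vee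 N)$. Then there is an event of probability at least $1-2\sum_{k=1}^Ke^{-N\pi_k/16}-\frac{2}{p\vee N}$ on which the minimization problem has a solution and every solution satisfies, for all $1\le k\le K'$, $$|\hat\beta_k-\beta_k|_\infty\le\zeta:=4C_0C_2\sqrt{\frac{\bar\pi\,\Sigma^+_{\max}(\Delta\vee K)\log(p\vee N)}{(\Sigma^+_{\min})^2(N-K)}} .$$ If in addition $|\beta_k^j|>2\zeta$ for all $1\le k\le K'$ and all $j\in T_k$, then on the same event $\mathrm{Supp}(\phi_\zeta(\hat\beta_k))=\mathrm{Supp}(\beta_k)$ for all $1\le k\le K'$. -/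

import Mathlib

open MeasureTheory ProbabilityTheory Matrix

namespace GroupLDA

/-! ### The model

There are `m + 1` classes, labelled by `Fin (m + 1)`; the reference (first) class is `0`, and
`k : Fin m` stands for the pair formed by the reference class and the class `k.succ`. -/

/-- `(X i, Y i)`, `i : Fin N`, are i.i.d. pairs with `ℙ(Y i = k) = π k` and, conditionally on
`Y i = k`, `X i` has the Gaussian law with mean `μ k` and covariance matrix `Sig`. (The prior
probabilities and the conditional laws determine the joint law of each pair, so the pairs are
identically distributed.) -/
structure IsSample {Ω : Type*} [MeasurableSpace Ω] (P : Measure Ω) {m p N : ℕ}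
    (π : Fin (m + 1) → ℝ) (μ : Fin (m + 1) → EuclideanSpace ℝ (Fin p))
    (Sig : Matrix (Fin p) (Fin p) ℝ)
    (X : Fin N → Ω → EuclideanSpace ℝ (Fin p)) (Y : Fin N → Ω → Fin (m + 1)) : Prop where
  measurable_X : ∀ i, Measurable (X i)
  measurable_Y : ∀ i, Measurable (Y i)
  indep : iIndepFun (fun i ω => (X i ω, Y i ω)) P
  label_law : ∀ i k, P.real {ω | Y i ω = k} = π k
  cond_law : ∀ i k,
    (ProbabilityTheory.cond P {ω | Y i ω = k}).map (X i) = multivariateGaussian (μ k) Sig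

/-! ### Matrix quantities -/

/-- The smallest diagonal entry. -/
noncomputable def diagMin {p : ℕ} (A : Matrix (Fin p) (Fin p) ℝ) : ℝ := ⨅ j, A j j

/-- The largest diagonal entry. -/
noncomputable def diagMax {p : ℕ} (A : Matrix (Fin p) (Fin p) ℝ) : ℝ := ⨆ j, A j j

/-- The largest absolute value of an off-diagonal entry (`0` for a `1 × 1` matrix). -/
noncomputable def offDiagMax {p : ℕ} (A : Matrix (Fin p) (Fin p) ℝ) : ℝ :=
  ⨆ q : {q : Fin p × Fin p // q.1 ≠ q.2}, |A q.1.1 q.1.2|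

/-! ### Population quantities -/

/-- `δ_k`, the difference of the mean of the reference class and the mean of class `k.succ`. -/
def delta {m p : ℕ} (μ : Fin (m + 1) → EuclideanSpace ℝ (Fin p)) (k : Fin m) : Fin p → ℝ :=
  fun j => μ 0 j - μ k.succ j

/-- The Bayes direction `β_k = Σ⁻¹ δ_k`. -/
noncomputable def bayesDir {m p : ℕ} (μ : Fin (m + 1) → EuclideanSpace ℝ (Fin p))
    (Sig : Matrix (Fin p) (Fin p) ℝ) (k : Fin m) : Fin p → ℝ :=
  Sig⁻¹ *ᵥ delta μ k

/-- `Δ = ∑ k, ⟨Σ⁻¹ δ_k, δ_k⟩`. -/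
noncomputable def signal {m p : ℕ} (μ : Fin (m + 1) → EuclideanSpace ℝ (Fin p))
    (Sig : Matrix (Fin p) (Fin p) ℝ) : ℝ :=
  ∑ k : Fin m, (Sig⁻¹ *ᵥ delta μ k) ⬝ᵥ delta μ k

/-- `s`, the cardinality of the union of the supports of the Bayes directions. -/
noncomputable def sparsity {m p : ℕ} (μ : Fin (m + 1) → EuclideanSpace ℝ (Fin p))
    (Sig : Matrix (Fin p) (Fin p) ℝ) : ℕ :=
  (⋃ k : Fin m, Function.support (bayesDir μ Sig k)).ncard

/-- The largest value over the nonreference classes of `(π_1 + π_k) / (π_1 π_k)`. -/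
noncomputable def piBar {m : ℕ} (π : Fin (m + 1) → ℝ) : ℝ :=
  ⨆ k : Fin m, (π 0 + π k.succ) / (π 0 * π k.succ)

/-! ### Statistics, as functions of the data `x i`, `y i` -/

/-- The number `n_k` of observations in class `k`. -/
def classCount {m N : ℕ} (y : Fin N → Fin (m + 1)) (k : Fin (m + 1)) : ℕ :=
  (Finset.univ.filter fun i => y i = k).card

/-- The sample mean of class `k`. -/
noncomputable def classMean {m p N : ℕ} (x : Fin N → EuclideanSpace ℝ (Fin p))
    (y : Fin N → Fin (m + 1)) (k : Fin (m + 1)) : EuclideanSpace ℝ (Fin p) :=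
  (classCount y k : ℝ)⁻¹ • ∑ i with y i = k, x i

/-- The pooled within-class sample covariance matrix, normalized by `N - K` with `K = m + 1`. -/
noncomputable def pooledCov {m p N : ℕ} (x : Fin N → EuclideanSpace ℝ (Fin p))
    (y : Fin N → Fin (m + 1)) : Matrix (Fin p) (Fin p) ℝ :=
  Matrix.of fun a b => ((N : ℝ) - ((m : ℝ) + 1))⁻¹ *
    ∑ k, ∑ i with y i = k, (x i a - classMean x y k a) * (x i b - classMean x y k b)

/-- The objective of the group-LASSO estimator at `B = (B_1, …, B_m)`; the group `j` consists of
the `j`-th entries of all the `B_k`, and its Euclidean norm is penalized. -/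
noncomputable def objective {m p : ℕ} (S : Matrix (Fin p) (Fin p) ℝ) (d : Fin m → Fin p → ℝ)
    (lam : Fin p → ℝ) (B : Fin m → Fin p → ℝ) : ℝ :=
  (∑ k, (1 / 2 : ℝ) * (B k ⬝ᵥ S *ᵥ B k)) - (∑ k, d k ⬝ᵥ B k)
    + ∑ j, lam j * ‖WithLp.toLp 2 (fun k => B k j)‖

/-- `B = (B_1, …, B_m)` is a group-LASSO estimate for the data `x`, `y`: a global minimizer of the
objective at the pooled covariance and the differences of the class sample means. -/
def IsEstimate {m p N : ℕ} (x : Fin N → EuclideanSpace ℝ (Fin p)) (y : Fin N → Fin (m + 1))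
    (lam : Fin p → ℝ) (B : Fin m → Fin p → ℝ) : Prop :=
  ∀ B' : Fin m → Fin p → ℝ,
    objective (pooledCov x y) (delta (classMean x y)) lam B ≤
      objective (pooledCov x y) (delta (classMean x y)) lam B'

/-- Hard thresholding at level `z`, entry by entry. -/
noncomputable def hardThreshold {p : ℕ} (z : ℝ) (v : Fin p → ℝ) : Fin p → ℝ :=
  fun j => if z ≤ |v j| then v j else 0

/-! ### The tuning parameter and the error level -/

/-- `λ_t = 2 C₀ √(π̄ Σ⁺_max (Δ ∨ K) t / (N - K))` with `K = m + 1`. -/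
noncomputable def tuning {m p : ℕ} (C₀ : ℝ) (π : Fin (m + 1) → ℝ)
    (μ : Fin (m + 1) → EuclideanSpace ℝ (Fin p)) (Sig : Matrix (Fin p) (Fin p) ℝ)
    (N : ℕ) (t : ℝ) : ℝ :=
  2 * C₀ * √(piBar π * diagMax Sig * max (signal μ Sig) ((m : ℝ) + 1) * t
    / ((N : ℝ) - ((m : ℝ) + 1)))

/-- `ζ = 4 C₀ C₂ √(π̄ Σ⁺_max (Δ ∨ K) log(p ∨ N) / ((Σ⁺_min)² (N - K)))` with `K = m + 1`. -/
noncomputable def errorLevel {m p : ℕ} (C₀ C₂ : ℝ) (π : Fin (m + 1) → ℝ)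
    (μ : Fin (m + 1) → EuclideanSpace ℝ (Fin p)) (Sig : Matrix (Fin p) (Fin p) ℝ)
    (N : ℕ) : ℝ :=
  4 * C₀ * C₂ * √(piBar π * diagMax Sig * max (signal μ Sig) ((m : ℝ) + 1)
    * Real.log (max (p : ℝ) (N : ℝ)) / (diagMin Sig ^ 2 * ((N : ℝ) - ((m : ℝ) + 1))))

end GroupLDA

/-! The proof combines a deterministic sup-norm bound for the group LASSO with Gaussian
concentration conditional on the labels.

Deterministic half (`sum_norm_error_le`, `norm_error_le`). Let D = B − β for a minimizer B. If every
group of the noise Sβ − δ̂ has norm at most λ/2, comparing the objective at B and β shows that the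
inactive groups of D weigh at most three times the active ones, while first-order optimality bounds
every group of SD by 3λ/2. Look at the row where the group norm of D attains its maximum r: the
diagonal entry of S is at least a/2 with a = Σ⁺_min, and off-diagonal entries of size at most
a/(32s) contribute at most (a/(32s))·4sr = ar/8 by the cone condition. Hence r ≤ 4λ/a, and a group
norm dominates each of its coordinates.

Probabilistic half (`quadForm_tail`, `noise_le`). Since Σβ_k = δ_k, the noise is (S − Σ)β − (δ̂ −
δ). Given the labels, the observations are independent Gaussian vectors, and (N − K) w'Sw / w'Σw is
a difference of two chi-squared variables with N and K degrees of freedom; their concentration and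
polarization (`bilinear_error_le`) control bilinear forms of S. Testing e_j against β_k gives an
error proportional to √⟨β_k, Σβ_k⟩, whose squares add up over k to Δ; the K − 1 mean errors add up
to the K in Δ ∨ K. Testing e_i against e_j transfers the coherence of Σ to S. With M = p ∨ N, a
union bound over O(M²) events of probability O(M⁻⁶) costs at most 2/M, and the lower tails of the
class counts give the exponential terms. -/

namespace GroupLDA

/-! ### Deterministic analysis of the group LASSO. -/

section Deterministic

variable {m p : ℕ} {S : Matrix (Fin p) (Fin p) ℝ} {d B β : Fin m → Fin p → ℝ} {l : ℝ}

/-- The group of the `j`-th entries of a family of vectors. -/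
noncomputable def group (B : Fin m → Fin p → ℝ) (j : Fin p) : EuclideanSpace ℝ (Fin m) :=
  WithLp.toLp 2 (fun k => B k j)

lemma group_add (B H : Fin m → Fin p → ℝ) (j : Fin p) :
    group (B + H) j = group B j + group H j := rfl

lemma group_sub (B H : Fin m → Fin p → ℝ) (j : Fin p) :
    group (B - H) j = group B j - group H j := rfl

lemma sum_dotProduct_eq_sum_inner (B H : Fin m → Fin p → ℝ) :
    ∑ k, B k ⬝ᵥ H k = ∑ j, inner ℝ (group B j) (group H j) := by
  simp only [dotProduct, PiLp.inner_apply, group]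
  rw [Finset.sum_comm]
  simp [mul_comm]

/-- The smooth part is quadratic, so its second-order expansion is exact. Taken at β it yields
coercivity and the cone condition; taken at a minimizer it yields first-order optimality. -/
lemma objective_add (hS : S.IsSymm) (B H : Fin m → Fin p → ℝ) :
    objective S d (fun _ => l) (B + H) = objective S d (fun _ => l) B
      + ∑ k, (S *ᵥ B k - d k) ⬝ᵥ H k + (1 / 2 : ℝ) * ∑ k, H k ⬝ᵥ S *ᵥ H k
      + l * ∑ j, (‖group (B + H) j‖ - ‖group B j‖) := by
  have hsymm (u v : Fin p → ℝ) : u ⬝ᵥ S *ᵥ v = v ⬝ᵥ S *ᵥ u := by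
    rw [dotProduct_mulVec, ← mulVec_transpose, hS.eq, dotProduct_comm]
  have e1 (k : Fin m) : (1 / 2 : ℝ) * ((B + H) k ⬝ᵥ S *ᵥ (B + H) k)
      = (1 / 2 : ℝ) * (B k ⬝ᵥ S *ᵥ B k) + (S *ᵥ B k) ⬝ᵥ H k
        + (1 / 2 : ℝ) * (H k ⬝ᵥ S *ᵥ H k) := by
    simp only [Pi.add_apply, mulVec_add, dotProduct_add, add_dotProduct]
    rw [hsymm (B k) (H k), dotProduct_comm (S *ᵥ B k) (H k)]
    ring
  unfold objective
  simp only [e1]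
  simp only [← Finset.mul_sum, Finset.sum_add_distrib, Finset.sum_sub_distrib,
    sub_dotProduct, Pi.add_apply, dotProduct_add]
  unfold group
  simp only [Pi.add_apply]
  ring

lemma sum_dotProduct_ge (W H : Fin m → Fin p → ℝ) {c : ℝ} (hW : ∀ j, ‖group W j‖ ≤ c) :
    -(c * ∑ j, ‖group H j‖) ≤ ∑ k, W k ⬝ᵥ H k := by
  rw [sum_dotProduct_eq_sum_inner, Finset.mul_sum, ← Finset.sum_neg_distrib]
  refine Finset.sum_le_sum fun j _ => ?_
  have h1 := (abs_le.mp (abs_real_inner_le_norm (group W j) (group H j))).1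
  have h2 : ‖group W j‖ * ‖group H j‖ ≤ c * ‖group H j‖ := by gcongr; exact hW j
  linarith

lemma quadForm_nonneg (hS : S.PosSemidef) (v : Fin p → ℝ) : 0 ≤ v ⬝ᵥ S *ᵥ v := by
  simpa using hS.dotProduct_mulVec_nonneg v

lemma continuous_objective : Continuous (objective (m := m) S d (fun _ => l)) := by
  unfold objective
  simp only [dotProduct, mulVec]
  fun_prop

/-- Existence of a group-LASSO solution when the noise is dominated by the penalty. -/
lemma exists_minimizer (hS : S.PosSemidef) (hl : 0 < l)
    (hW : ∀ j, ‖group (fun k => S *ᵥ β k - d k) j‖ ≤ l / 2) :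
    ∃ B, ∀ B', objective S d (fun _ => l) B ≤ objective S d (fun _ => l) B' := by
  have hsymm : S.IsSymm := by simpa using! hS.isHermitian
  -- The noise costs at most l/2 times the sum of the group norms of B − β, and the penalty changes
  -- by l times the difference of the sums for B and β. With the triangle inequality, l/2 times the
  -- sum for B survives, which makes the objective coercive.
  set c := objective S d (fun _ => l) β - (3 / 2 * l) * ∑ j, ‖group β j‖
  have key (B : Fin m → Fin p → ℝ) :
      c + l / 2 * ‖B‖ ≤ objective S d (fun _ => l) B := by
    have h := objective_add (d := d) (l := l) hsymm β (B - β)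
    rw [add_sub_cancel] at h
    have h1 := sum_dotProduct_ge _ (B - β) hW
    have h2 : 0 ≤ ∑ k, (B - β) k ⬝ᵥ S *ᵥ (B - β) k :=
      Finset.sum_nonneg fun k _ => quadForm_nonneg hS _
    have h3 : ∑ j, ‖group (B - β) j‖ ≤ ∑ j, ‖group B j‖ + ∑ j, ‖group β j‖ := by
      rw [← Finset.sum_add_distrib]
      exact Finset.sum_le_sum fun j _ => by rw [group_sub]; exact norm_sub_le _ _
    have h4 : ‖B‖ ≤ ∑ j, ‖group B j‖ := by
      have h0 : 0 ≤ ∑ j, ‖group B j‖ := Finset.sum_nonneg fun _ _ => norm_nonneg _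
      refine (pi_norm_le_iff_of_nonneg h0).2 fun k => (pi_norm_le_iff_of_nonneg h0).2 fun j => ?_
      calc ‖B k j‖ = ‖group B j k‖ := rfl
        _ ≤ ‖group B j‖ := PiLp.norm_apply_le _ _
        _ ≤ _ := Finset.single_le_sum (f := fun j => ‖group B j‖)
          (fun _ _ => norm_nonneg _) (Finset.mem_univ j)
    rw [Finset.sum_sub_distrib] at h
    have h5 := mul_le_mul_of_nonneg_left h3 hl.le
    have h6 := mul_le_mul_of_nonneg_left h4 hl.le
    simp only [c]
    nlinarith
  refine continuous_objective.exists_forall_le ?_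
  refine Filter.tendsto_atTop_mono key ?_
  exact Filter.tendsto_atTop_add_const_left _ _
    ((tendsto_norm_cocompact_atTop).const_mul_atTop (by positivity))

/-- First-order optimality: the gradient of the smooth part is dominated by the penalty. -/
lemma norm_gradient_le (hS : S.IsSymm) (hl : 0 < l)
    (hB : ∀ B', objective S d (fun _ => l) B ≤ objective S d (fun _ => l) B') (j : Fin p) :
    ‖group (fun k => S *ᵥ B k - d k) j‖ ≤ l := by
  set G := group (fun k => S *ᵥ B k - d k) j with hG
  by_contra! hcon
  have hpos : 0 < ‖G‖ := hl.trans hcon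
  have key (e : ℝ) (he : 0 < e) :
      0 ≤ -(e * ‖G‖ ^ 2) + e ^ 2 / 2 * (S j j * ‖G‖ ^ 2) + l * (e * ‖G‖) := by
    -- Descent along the gradient within the single group j: the linear gain e‖G‖² beats the penalty
    -- cost l e‖G‖ as soon as ‖G‖ > l and e is small.
    set H : Fin m → Fin p → ℝ := fun k => Pi.single j (-e * G k) with hH
    have h := objective_add (d := d) (l := l) hS B H
    have h0 := hB (B + H)
    have e1 : ∑ k, (S *ᵥ B k - d k) ⬝ᵥ H k = -(e * ‖G‖ ^ 2) := by
      rw [EuclideanSpace.real_norm_sq_eq, Finset.mul_sum, ← Finset.sum_neg_distrib]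
      refine Finset.sum_congr rfl fun k _ => ?_
      simp only [hH, dotProduct_single]
      rw [show (S *ᵥ B k - d k) j = G k from rfl]
      ring
    have e2 : ∑ k, H k ⬝ᵥ S *ᵥ H k = e ^ 2 * (S j j * ‖G‖ ^ 2) := by
      rw [EuclideanSpace.real_norm_sq_eq, Finset.mul_sum, Finset.mul_sum]
      refine Finset.sum_congr rfl fun k _ => ?_
      simp [hH, single_dotProduct]
      ring
    have e3 : ∑ i, (‖group (B + H) i‖ - ‖group B i‖) ≤ e * ‖G‖ := by
      have hz (i : Fin p) (hi : i ≠ j) : group H i = 0 := by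
        ext k; simp [group, hH, hi]
      have hj : group H j = (-e) • G := by
        ext k; simp [group, hH]
      rw [Finset.sum_eq_single j]
      · rw [group_add]
        have := norm_add_le (group B j) (group H j)
        rw [hj, norm_smul, Real.norm_eq_abs, abs_neg, abs_of_pos he] at this
        rw [hj]; linarith
      · intro i _ hi
        rw [group_add, hz i hi]; simp
      · simp
    have e4 := mul_le_mul_of_nonneg_left e3 hl.le
    rw [e1, e2] at h
    linarith
  set q := S j j * ‖G‖ ^ 2
  set g := ‖G‖ * (‖G‖ - l) with hg
  have hgpos : 0 < g := mul_pos hpos (by linarith)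
  -- This step size makes the quadratic term at most half of the linear gain g.
  have h2 := key (g / (|q| + 1)) (by positivity)
  set e := g / (|q| + 1) with he
  have hepos : 0 < e := by positivity
  have h3 : e * (|q| + 1) = g := by rw [he]; field_simp
  have h4 : e * q ≤ e * |q| := mul_le_mul_of_nonneg_left (le_abs_self q) hepos.le
  have h5 : 0 ≤ e * (-g + e * q / 2) := by rw [hg]; linarith
  have h6 : 0 ≤ -g + e * q / 2 := nonneg_of_mul_nonneg_right h5 hepos
  linarith

/-- The estimation error of a group-LASSO solution lies in a cone around the active groups. -/
lemma sum_norm_error_le (hS : S.PosSemidef) (hl : 0 < l)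
    (hW : ∀ j, ‖group (fun k => S *ᵥ β k - d k) j‖ ≤ l / 2) (T : Finset (Fin p))
    (hT : ∀ j ∉ T, ∀ k, β k j = 0)
    (hB : ∀ B', objective S d (fun _ => l) B ≤ objective S d (fun _ => l) B') :
    ∑ j, ‖group (B - β) j‖ ≤ 4 * ∑ j ∈ T, ‖group (B - β) j‖ := by
  have hsymm : S.IsSymm := by simpa using! hS.isHermitian
  have h := objective_add (d := d) (l := l) hsymm β (B - β)
  rw [add_sub_cancel] at h
  have h0 := hB β
  have h1 := sum_dotProduct_ge _ (B - β) hW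
  have h2 : 0 ≤ ∑ k, (B - β) k ⬝ᵥ S *ᵥ (B - β) k :=
    Finset.sum_nonneg fun k _ => quadForm_nonneg hS _
  have h3 : ∑ j ∈ Tᶜ, ‖group (B - β) j‖ - ∑ j ∈ T, ‖group (B - β) j‖
      ≤ ∑ j, (‖group B j‖ - ‖group β j‖) := by
    rw [← Finset.sum_add_sum_compl T, sub_eq_add_neg, add_comm, ← Finset.sum_neg_distrib]
    refine add_le_add (Finset.sum_le_sum fun j _ => ?_) (Finset.sum_le_sum fun j hj => ?_)
    · rw [group_sub]
      have := norm_sub_norm_le (group β j) (group B j)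
      rw [norm_sub_rev] at this
      linarith
    · have hz : group β j = 0 := by
        ext k
        exact hT j (Finset.mem_compl.1 hj) k
      rw [group_sub, hz]; simp
  rw [← Finset.sum_add_sum_compl T] at h1 ⊢
  have h4 := mul_le_mul_of_nonneg_left h3 hl.le
  have h5 : 0 ≤ l * (3 * ∑ j ∈ T, ‖group (B - β) j‖ - ∑ j ∈ Tᶜ, ‖group (B - β) j‖) := by
    linarith
  have h6 := nonneg_of_mul_nonneg_right h5 hl
  linarith

/-- Sup-norm error bound for the group LASSO under a mutual coherence condition. -/
lemma norm_error_le (hS : S.PosSemidef) (hl : 0 < l)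
    (hW : ∀ j, ‖group (fun k => S *ᵥ β k - d k) j‖ ≤ l / 2) (T : Finset (Fin p))
    (hT : ∀ j ∉ T, ∀ k, β k j = 0) {a : ℝ} (ha : 0 < a)
    (hdiag : T.Nonempty → ∀ j, a / 2 ≤ S j j)
    (hoff : T.Nonempty → ∀ i j, i ≠ j → |S i j| * (32 * T.card) ≤ a)
    (hB : ∀ B', objective S d (fun _ => l) B ≤ objective S d (fun _ => l) B') (j : Fin p) :
    ‖group (B - β) j‖ ≤ 4 * l / a := by
  have hsymm : S.IsSymm := by simpa using! hS.isHermitian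
  have hcone := sum_norm_error_le hS hl hW T hT hB
  -- With no active group the cone condition forces B = β, so nothing is needed from S beyond
  -- positive semidefiniteness.
  rcases T.eq_empty_or_nonempty with rfl | hne
  · rw [Finset.sum_empty, mul_zero] at hcone
    have := Finset.single_le_sum (f := fun j => ‖group (B - β) j‖)
          (fun _ _ => norm_nonneg _) (Finset.mem_univ j)
    exact (this.trans hcone).trans (by positivity)
  obtain ⟨j₀, -, hj₀⟩ := Finset.exists_max_image Finset.univ (fun j => ‖group (B - β) j‖)
    ⟨j, Finset.mem_univ j⟩
  set D := B - β with hD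
  set r := ‖group D j₀‖ with hr
  refine (hj₀ j (Finset.mem_univ j)).trans ?_
  have hs : (0 : ℝ) < T.card := by exact_mod_cast hne.card_pos
  have hsum : ∑ j, ‖group D j‖ ≤ 4 * (T.card * r) := by
    refine hcone.trans ?_
    gcongr
    calc ∑ j ∈ T, ‖group D j‖ ≤ ∑ j ∈ T, r :=
          Finset.sum_le_sum fun j _ => hj₀ j (Finset.mem_univ j)
      _ = _ := by simp
  have hgrad : ‖group (fun k => S *ᵥ D k) j₀‖ ≤ 3 / 2 * l := by
    have e : group (fun k => S *ᵥ D k) j₀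
        = group (fun k => S *ᵥ B k - d k) j₀ - group (fun k => S *ᵥ β k - d k) j₀ := by
      ext k
      simp [group, hD, mulVec_sub]
    rw [e]
    have := norm_sub_le (group (fun k => S *ᵥ B k - d k) j₀) (group (fun k => S *ᵥ β k - d k) j₀)
    have := norm_gradient_le hsymm hl hB j₀
    have := hW j₀
    linarith
  have hexp : group (fun k => S *ᵥ D k) j₀
      = S j₀ j₀ • group D j₀ + ∑ i ∈ Finset.univ.erase j₀, S j₀ i • group D i := by
    rw [Finset.add_sum_erase _ (fun i => S j₀ i • group D i) (Finset.mem_univ j₀)]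
    ext k
    simp [group, mulVec, dotProduct]
  have hrest : ‖∑ i ∈ Finset.univ.erase j₀, S j₀ i • group D i‖ ≤ a / 8 * r := by
    calc _ ≤ ∑ i ∈ Finset.univ.erase j₀, a / (32 * T.card) * ‖group D i‖ := by
          refine norm_sum_le_of_le _ fun i hi => ?_
          rw [norm_smul, Real.norm_eq_abs]
          gcongr
          rw [le_div_iff₀ (by positivity)]
          exact hoff hne _ _ (Finset.ne_of_mem_erase hi).symm
      _ ≤ ∑ i, a / (32 * T.card) * ‖group D i‖ :=
          Finset.sum_le_sum_of_subset_of_nonneg (Finset.subset_univ _)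
            fun _ _ _ => by positivity
      _ = a / (32 * T.card) * ∑ i, ‖group D i‖ := by rw [Finset.mul_sum]
      _ ≤ a / (32 * T.card) * (4 * (T.card * r)) := by gcongr
      _ = a / 8 * r := by field_simp; ring
  have hmain : a / 2 * r ≤ 3 / 2 * l + a / 8 * r := by
    calc a / 2 * r ≤ S j₀ j₀ * r := by gcongr; exact hdiag hne j₀
      _ ≤ ‖S j₀ j₀ • group D j₀‖ := by
          rw [norm_smul, Real.norm_eq_abs]; gcongr; exact le_abs_self _
      _ = ‖group (fun k => S *ᵥ D k) j₀ - ∑ i ∈ Finset.univ.erase j₀, S j₀ i • group D i‖ := by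
          rw [hexp, add_sub_cancel_right]
      _ ≤ _ := (norm_sub_le _ _).trans (add_le_add hgrad hrest)
  rw [le_div_iff₀ ha]
  linarith

end Deterministic

/-! ### Chi-squared and Gaussian tails. -/

section Gaussian

variable {Ω : Type*} [MeasurableSpace Ω] {Q : Measure Ω}

lemma exp_mul_sq_eq (θ x : ℝ) :
    gaussianPDFReal 0 1 x * Real.exp (θ * x ^ 2)
      = (√(2 * Real.pi))⁻¹ * Real.exp (-(1 / 2 - θ) * x ^ 2) := by
  rw [gaussianPDFReal, mul_assoc, ← Real.exp_add]
  congr 2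
  · simp
  · simp; ring

lemma integrable_exp_mul_sq {θ : ℝ} (hθ : θ ≤ 1 / 4) :
    Integrable (fun x => Real.exp (θ * x ^ 2)) (gaussianReal 0 1) := by
  rw [gaussianReal_of_var_ne_zero _ one_ne_zero,
    integrable_withDensity_iff_integrable_smul' (measurable_gaussianPDF 0 1)
      (Filter.Eventually.of_forall fun _ => gaussianPDF_lt_top)]
  simp only [toReal_gaussianPDF, smul_eq_mul, exp_mul_sq_eq]
  exact (integrable_exp_neg_mul_sq (by linarith)).const_mul _

lemma integral_exp_mul_sq {θ : ℝ} (hθ : θ ≤ 1 / 4) :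
    ∫ x, Real.exp (θ * x ^ 2) ∂gaussianReal 0 1 = (√(1 - 2 * θ))⁻¹ := by
  rw [integral_gaussianReal_eq_integral_smul one_ne_zero]
  simp only [smul_eq_mul, exp_mul_sq_eq]
  rw [integral_const_mul, integral_gaussian, ← Real.sqrt_inv, ← Real.sqrt_mul (by positivity),
    ← Real.sqrt_inv]
  congr 1
  have : 1 - 2 * θ ≠ 0 := by linarith
  have : 1 / 2 - θ ≠ 0 := by linarith
  have := Real.pi_ne_zero
  field_simp

/-- After squaring, the claim is 1 ≤ (1 − 2θ) exp(2θ + 4θ²). For θ ≤ 0 the linear lower bound on exp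
suffices, because (1 − 2θ)(1 + 2θ + 4θ²) = 1 − 8θ³; for θ ≥ 0 the quadratic term is needed. -/
lemma inv_sqrt_one_sub_le {θ : ℝ} (h : |θ| ≤ 1 / 4) :
    (√(1 - 2 * θ))⁻¹ ≤ Real.exp (θ + 2 * θ ^ 2) := by
  obtain ⟨h1, h2⟩ := abs_le.1 h
  have hexp : 1 ≤ (1 - 2 * θ) * Real.exp (2 * (θ + 2 * θ ^ 2)) := by
    rcases le_total θ 0 with h0 | h0
    · have := Real.add_one_le_exp (2 * (θ + 2 * θ ^ 2))
      have h3 : (1 - 2 * θ) * (2 * (θ + 2 * θ ^ 2) + 1)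
          ≤ (1 - 2 * θ) * Real.exp (2 * (θ + 2 * θ ^ 2)) :=
        mul_le_mul_of_nonneg_left this (by linarith)
      nlinarith [mul_nonneg (neg_nonneg.2 h0) (sq_nonneg θ)]
    · have := Real.quadratic_le_exp_of_nonneg (x := 2 * (θ + 2 * θ ^ 2)) (by positivity)
      have h3 := mul_le_mul_of_nonneg_left this (show 0 ≤ 1 - 2 * θ by linarith)
      refine le_trans ?_ h3
      have h4 : 0 ≤ θ ^ 2 * ((1 - 2 * θ) * (1 + 2 * θ) ^ 2 - 4 * θ) := by
        refine mul_nonneg (sq_nonneg θ) ?_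
        nlinarith [mul_nonneg h0 (show 0 ≤ 1 / 4 - θ by linarith),
          mul_nonneg h0 (mul_nonneg h0 (show 0 ≤ 1 / 4 - θ by linarith))]
      nlinarith
  have hpos : 0 < √(1 - 2 * θ) := Real.sqrt_pos.2 (by linarith)
  rw [inv_le_iff_one_le_mul₀ hpos, mul_comm]
  refine (Real.one_le_sqrt.2 hexp).trans (le_of_eq ?_)
  rw [Real.sqrt_mul (by linarith), show 2 * (θ + 2 * θ ^ 2)
    = (θ + 2 * θ ^ 2) + (θ + 2 * θ ^ 2) by ring, Real.exp_add,
    Real.sqrt_mul_self (Real.exp_pos _).le]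

variable {ι : Type*} [Fintype ι] {Z : ι → Ω → ℝ}

lemma integrable_exp_mul_sq_of_hasLaw {Z : Ω → ℝ} (hZ : HasLaw Z (gaussianReal 0 1) Q) {θ : ℝ}
    (hθ : θ ≤ 1 / 4) : Integrable (fun ω => Real.exp (θ * Z ω ^ 2)) Q := by
  have h := integrable_exp_mul_sq hθ
  rw [← hZ.map_eq] at h
  exact h.comp_aemeasurable hZ.aemeasurable

lemma mgf_sq_le {Z : Ω → ℝ} (hZ : HasLaw Z (gaussianReal 0 1) Q) {θ : ℝ} (hθ : |θ| ≤ 1 / 4) :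
    mgf (fun ω => Z ω ^ 2) Q θ ≤ Real.exp (θ + 2 * θ ^ 2) := by
  have h := hZ.integral_comp (f := fun x => Real.exp (θ * x ^ 2)) (by fun_prop)
  refine le_trans (le_of_eq ?_) (inv_sqrt_one_sub_le hθ)
  rw [← integral_exp_mul_sq (abs_le.1 hθ).2, ← h]
  rfl

lemma mgf_sum_sq_le (hind : iIndepFun Z Q) (hmeas : ∀ i, Measurable (Z i))
    (hZ : ∀ i, HasLaw (Z i) (gaussianReal 0 1) Q) {θ : ℝ} (hθ : |θ| ≤ 1 / 4) :
    Integrable (fun ω => Real.exp (θ * ∑ i, Z i ω ^ 2)) Q ∧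
      mgf (fun ω => ∑ i, Z i ω ^ 2) Q θ ≤ Real.exp (Fintype.card ι * (θ + 2 * θ ^ 2)) := by
  have := hind.isProbabilityMeasure
  have hind2 : iIndepFun (fun i ω => Z i ω ^ 2) Q :=
    hind.comp (fun _ x => x ^ 2) fun _ => by fun_prop
  have hmeas2 (i : ι) : Measurable (fun ω => Z i ω ^ 2) := by fun_prop
  have e : (fun ω => ∑ i, Z i ω ^ 2) = ∑ i, fun ω => Z i ω ^ 2 := by ext; simp
  constructor
  · have := hind2.integrable_exp_mul_sum (t := θ) hmeas2 (s := Finset.univ)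
      fun i _ => integrable_exp_mul_sq_of_hasLaw (hZ i) (abs_le.1 hθ).2
    simpa using this
  · rw [e, hind2.mgf_sum hmeas2, Real.exp_nat_mul]
    calc _ ≤ ∏ _i : ι, Real.exp (θ + 2 * θ ^ 2) :=
          Finset.prod_le_prod (fun _ _ => mgf_nonneg) fun i _ => mgf_sq_le (hZ i) hθ
      _ = _ := by simp

/-- Two-sided concentration of a chi-squared variable. -/
lemma sum_sq_tail (hind : iIndepFun Z Q) (hmeas : ∀ i, Measurable (Z i))
    (hZ : ∀ i, HasLaw (Z i) (gaussianReal 0 1) Q) {θ n : ℝ} (hθ0 : 0 ≤ θ) (hθ : θ ≤ 1 / 4)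
    (hn : Fintype.card ι ≤ n) (x : ℝ) :
    Q.real {ω | x ≤ |∑ i, Z i ω ^ 2 - Fintype.card ι|}
      ≤ 2 * Real.exp (-θ * x + 2 * n * θ ^ 2) := by
  have := hind.isProbabilityMeasure
  obtain ⟨i1, b1⟩ := mgf_sum_sq_le hind hmeas hZ (θ := θ) (by rwa [abs_of_nonneg hθ0])
  obtain ⟨i2, b2⟩ := mgf_sum_sq_le hind hmeas hZ (θ := -θ) (by rwa [abs_neg, abs_of_nonneg hθ0])
  have u1 := measure_ge_le_exp_mul_mgf (X := fun ω => ∑ i, Z i ω ^ 2)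
    (Fintype.card ι + x) hθ0 i1
  have u2 := measure_le_le_exp_mul_mgf (X := fun ω => ∑ i, Z i ω ^ 2)
    (Fintype.card ι - x) (neg_nonpos.2 hθ0) i2
  have hθn := mul_le_mul_of_nonneg_right hn (sq_nonneg θ)
  have v1 : Real.exp (-θ * (Fintype.card ι + x)) * mgf (fun ω => ∑ i, Z i ω ^ 2) Q θ
      ≤ Real.exp (-θ * x + 2 * n * θ ^ 2) := by
    refine (mul_le_mul_of_nonneg_left b1 (Real.exp_pos _).le).trans ?_
    rw [← Real.exp_add, Real.exp_le_exp]
    linarith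
  have v2 : Real.exp (- -θ * (Fintype.card ι - x)) * mgf (fun ω => ∑ i, Z i ω ^ 2) Q (-θ)
      ≤ Real.exp (-θ * x + 2 * n * θ ^ 2) := by
    refine (mul_le_mul_of_nonneg_left b2 (Real.exp_pos _).le).trans ?_
    rw [← Real.exp_add, Real.exp_le_exp]
    linarith
  have hsub : {ω | x ≤ |∑ i, Z i ω ^ 2 - Fintype.card ι|}
      ⊆ {ω | Fintype.card ι + x ≤ ∑ i, Z i ω ^ 2} ∪ {ω | ∑ i, Z i ω ^ 2 ≤ Fintype.card ι - x} := by
    intro ω hω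
    simp only [Set.mem_union, Set.mem_ofPred_eq] at hω ⊢
    rcases le_abs.1 hω with h | h
    · left; linarith
    · right; linarith
  have h3 := (measureReal_mono hsub (measure_ne_top Q _)).trans (measureReal_union_le _ _)
  linarith

/-- Two-sided tail bound for a standard Gaussian variable. -/
lemma gaussian_tail {Z : Ω → ℝ} (hZ : HasLaw Z (gaussianReal 0 1) Q) {x : ℝ} (hx : 0 ≤ x) :
    Q.real {ω | x ≤ |Z ω|} ≤ 2 * Real.exp (-(x ^ 2 / 2)) := by
  have := hZ.isProbabilityMeasure
  have hint (t : ℝ) : Integrable (fun ω => Real.exp (t * Z ω)) Q := by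
    have h := integrable_exp_mul_gaussianReal (μ := 0) (v := 1) t
    rw [← hZ.map_eq] at h
    exact h.comp_aemeasurable hZ.aemeasurable
  have u1 := measure_ge_le_exp_mul_mgf (X := Z) x hx (hint _)
  have u2 := measure_le_le_exp_mul_mgf (X := Z) (-x) (neg_nonpos.2 hx) (hint _)
  rw [mgf_gaussianReal hZ.map_eq, ← Real.exp_add] at u1 u2
  have e1 : -x * x + (0 * x + ((1 : NNReal) : ℝ) * x ^ 2 / 2) = -(x ^ 2 / 2) := by
    simp; ring
  have e2 : - -x * -x + (0 * -x + ((1 : NNReal) : ℝ) * (-x) ^ 2 / 2) = -(x ^ 2 / 2) := by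
    simp; ring
  rw [e1] at u1
  rw [e2] at u2
  have hsub : {ω | x ≤ |Z ω|} ⊆ {ω | x ≤ Z ω} ∪ {ω | Z ω ≤ -x} := by
    intro ω hω
    simp only [Set.mem_union, Set.mem_ofPred_eq] at hω ⊢
    rcases le_abs.1 hω with h | h
    · left; linarith
    · right; linarith
  have h3 := (measureReal_mono hsub (measure_ne_top Q _)).trans (measureReal_union_le _ _)
  linarith

/-- Orthonormal combinations of independent standard Gaussian variables are independent standard
Gaussian variables. -/
lemma orthonormal_combination {κ : Type*} [Fintype κ] [DecidableEq κ] (hind : iIndepFun Z Q)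
    (hmeas : ∀ i, Measurable (Z i))
    (hZ : ∀ i, HasLaw (Z i) (gaussianReal 0 1) Q) (c : κ → ι → ℝ)
    (hc : ∀ k l, ∑ i, c k i * c l i = if k = l then 1 else 0) :
    iIndepFun (fun k ω => ∑ i, c k i * Z i ω) Q ∧
      ∀ k, HasLaw (fun ω => ∑ i, c k i * Z i ω) (gaussianReal 0 1) Q := by
  classical
  have := hind.isProbabilityMeasure
  have hG := fun i => (hZ i).hasGaussianLaw
  -- Joint Gaussianity, not only Gaussian marginals, is what turns vanishing covariances into
  -- independence.
  have hjoint : HasGaussianLaw (fun ω k => ∑ i, c k i * Z i ω) Q :=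
    (hind.hasGaussianLaw hG).map_fun
      (ContinuousLinearMap.pi fun k => ∑ i, c k i • ContinuousLinearMap.proj (R := ℝ) i) |>.congr
      (Filter.Eventually.of_forall fun ω => by ext k; simp)
  have hL2 (i : ι) : MemLp (Z i) 2 Q := (hG i).memLp_two
  have hcov (i j : ι) : cov[Z i, Z j; Q] = if i = j then 1 else 0 := by
    split_ifs with h
    · subst h
      rw [covariance_self (hZ i).aemeasurable, (hZ i).variance_eq]
      simp
    · exact (hind.indepFun h).covariance_eq_zero (hL2 i) (hL2 j)
  have hcovG (k l : κ) : cov[fun ω => ∑ i, c k i * Z i ω, fun ω => ∑ i, c l i * Z i ω; Q]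
      = if k = l then 1 else 0 := by
    rw [covariance_fun_sum_fun_sum (fun i => (hL2 i).const_mul _) fun i => (hL2 i).const_mul _]
    simp only [covariance_const_mul_left, covariance_const_mul_right, hcov]
    simp [hc, eq_comm]
  refine ⟨hjoint.iIndepFun_of_covariance_eq_zero fun k l hkl => ?_, fun k => ⟨by fun_prop, ?_⟩⟩
  · rw [hcovG, if_neg hkl]
  · have hk : HasGaussianLaw (fun ω => ∑ i, c k i * Z i ω) Q :=
      hjoint.map_fun (ContinuousLinearMap.proj (R := ℝ) k)
    rw [hk.map_eq_gaussianReal, ← covariance_self (by fun_prop), hcovG, if_pos rfl]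
    have hmean (i : ι) : ∫ ω, Z i ω ∂Q = 0 := by rw [(hZ i).integral_eq]; simp
    rw [integral_finsetSum _ fun i _ => ((hG i).integrable).const_mul _]
    simp [integral_const_mul, hmean]

/-- A linear functional of a multivariate Gaussian vector is Gaussian. -/
lemma hasLaw_dotProduct {p : ℕ} {X : Ω → EuclideanSpace ℝ (Fin p)} {Sig : Matrix (Fin p) (Fin p) ℝ}
    (hS : Sig.PosDef) (ν : EuclideanSpace ℝ (Fin p)) (hX : HasLaw X (multivariateGaussian ν Sig) Q)
    {w : Fin p → ℝ} (hw : w ≠ 0) :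
    HasLaw (fun ω => (√(w ⬝ᵥ Sig *ᵥ w))⁻¹ * ∑ a, w a * (X ω a - ν a)) (gaussianReal 0 1) Q := by
  set L : StrongDual ℝ (EuclideanSpace ℝ (Fin p)) := innerSL ℝ (WithLp.toLp 2 w) with hLdef
  have hL (x : EuclideanSpace ℝ (Fin p)) : L x = ∑ a, w a * x a := by
    simp [hLdef, PiLp.inner_apply, mul_comm]
  have hpos : 0 < w ⬝ᵥ Sig *ᵥ w := by simpa using! hS.dotProduct_mulVec_pos hw
  have hlaw : HasLaw L (gaussianReal (L ν) (w ⬝ᵥ Sig *ᵥ w).toNNReal)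
      (multivariateGaussian ν Sig) := by
    refine ⟨by fun_prop, ?_⟩
    rw [IsGaussian.map_eq_gaussianReal]
    congr 2
    · rw [L.integral_comp_id_comm IsGaussian.integrable_id, integral_id_multivariateGaussian]
    · have := covarianceBilin_multivariateGaussian (μ := ν) hS.posSemidef (WithLp.toLp 2 w)
        (WithLp.toLp 2 w)
      rw [covarianceBilin_self IsGaussian.memLp_two_id] at this
      exact this
  have h1 := (gaussianReal_const_mul (gaussianReal_sub_const (hlaw.fun_comp hX) (L ν))
    (√(w ⬝ᵥ Sig *ᵥ w))⁻¹)
  convert h1 using 2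
  · rw [hL, hL, ← Finset.sum_sub_distrib]
    simp only [mul_sub]
  · simp
  · ext
    simp [Real.sq_sqrt hpos.le, max_eq_left hpos.le, hpos.ne']

end Gaussian

/-! ### From quadratic to bilinear forms. -/

section Polarization

variable {p : ℕ}

lemma quadForm_smul_add_smul {A : Matrix (Fin p) (Fin p) ℝ} (hA : A.IsSymm) (a b : ℝ)
    (u v : Fin p → ℝ) :
    (a • u + b • v) ⬝ᵥ A *ᵥ (a • u + b • v)
      = a ^ 2 * (u ⬝ᵥ A *ᵥ u) + 2 * a * b * (u ⬝ᵥ A *ᵥ v) + b ^ 2 * (v ⬝ᵥ A *ᵥ v) := by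
  have hsymm : v ⬝ᵥ A *ᵥ u = u ⬝ᵥ A *ᵥ v := by
    rw [dotProduct_mulVec, ← mulVec_transpose, hA.eq, dotProduct_comm]
  simp only [mulVec_add, mulVec_smul, dotProduct_add, add_dotProduct, dotProduct_smul,
    smul_dotProduct, smul_eq_mul, hsymm]
  ring

lemma quadForm_pos {A : Matrix (Fin p) (Fin p) ℝ} (hA : A.PosDef) {w : Fin p → ℝ} (hw : w ≠ 0) :
    0 < w ⬝ᵥ A *ᵥ w := by
  simpa using! hA.dotProduct_mulVec_pos hw

/-- Relative errors of bilinear forms are controlled by relative errors of quadratic forms. -/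
lemma bilinear_error_le {S A : Matrix (Fin p) (Fin p) ℝ} (hS : S.IsSymm) (hA : A.PosDef) {e : ℝ}
    (u v : Fin p → ℝ)
    (h : ∀ σ : ℝ, |σ| = 1 →
      |((√(u ⬝ᵥ A *ᵥ u))⁻¹ • u + (σ * (√(v ⬝ᵥ A *ᵥ v))⁻¹) • v) ⬝ᵥ
          S *ᵥ ((√(u ⬝ᵥ A *ᵥ u))⁻¹ • u + (σ * (√(v ⬝ᵥ A *ᵥ v))⁻¹) • v)
        - ((√(u ⬝ᵥ A *ᵥ u))⁻¹ • u + (σ * (√(v ⬝ᵥ A *ᵥ v))⁻¹) • v) ⬝ᵥ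
          A *ᵥ ((√(u ⬝ᵥ A *ᵥ u))⁻¹ • u + (σ * (√(v ⬝ᵥ A *ᵥ v))⁻¹) • v)|
      ≤ e * (((√(u ⬝ᵥ A *ᵥ u))⁻¹ • u + (σ * (√(v ⬝ᵥ A *ᵥ v))⁻¹) • v) ⬝ᵥ
          A *ᵥ ((√(u ⬝ᵥ A *ᵥ u))⁻¹ • u + (σ * (√(v ⬝ᵥ A *ᵥ v))⁻¹) • v))) :
    |u ⬝ᵥ S *ᵥ v - u ⬝ᵥ A *ᵥ v| ≤ e * (√(u ⬝ᵥ A *ᵥ u) * √(v ⬝ᵥ A *ᵥ v)) := by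
  have hAs : A.IsSymm := by simpa using! hA.isHermitian
  rcases eq_or_ne u 0 with rfl | hu
  · simp
  rcases eq_or_ne v 0 with rfl | hv
  · simp
  have hU := quadForm_pos hA hu
  have hV := quadForm_pos hA hv
  have hp := Real.sqrt_pos.2 hU
  have hq := Real.sqrt_pos.2 hV
  have eU := Real.sq_sqrt hU.le
  have eV := Real.sq_sqrt hV.le
  simp only [quadForm_smul_add_smul hS, quadForm_smul_add_smul hAs] at h
  have h1 := h 1 (by simp)
  have h2 := h (-1) (by simp)
  set P := √(u ⬝ᵥ A *ᵥ u)
  set R := √(v ⬝ᵥ A *ᵥ v)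
  rw [← eU, ← eV] at h1 h2
  obtain ⟨h1a, h1b⟩ := abs_le.1 h1
  obtain ⟨h2a, h2b⟩ := abs_le.1 h2
  have c1 : P⁻¹ ^ 2 * P ^ 2 = 1 := by field_simp
  have c2 : R⁻¹ ^ 2 * R ^ 2 = 1 := by field_simp
  -- For unit vectors u' and v', the two A-forms of u' ± v' sum to 4, cancelling the 1/4 of
  -- polarization.
  have key : |P⁻¹ * R⁻¹ * (u ⬝ᵥ S *ᵥ v - u ⬝ᵥ A *ᵥ v)| ≤ e := by
    rw [abs_le]
    constructor
    · linear_combination (1 / 4) * h1a + (1 / 4) * h2b + (1 / 2) * e * c1 + (1 / 2) * e * c2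
    · linear_combination (1 / 4) * h1b + (1 / 4) * h2a + (1 / 2) * e * c1 + (1 / 2) * e * c2
  rw [abs_mul, abs_of_pos (by positivity : 0 < P⁻¹ * R⁻¹)] at key
  calc _ = P * R * (P⁻¹ * R⁻¹ * |u ⬝ᵥ S *ᵥ v - u ⬝ᵥ A *ᵥ v|) := by field_simp
    _ ≤ P * R * e := by gcongr
    _ = _ := by ring

end Polarization

/-! ### Algebra of the class means and the pooled covariance. -/

section Sample

variable {m p N : ℕ}

lemma pooledCov_isSymm (x : Fin N → EuclideanSpace ℝ (Fin p)) (y : Fin N → Fin (m + 1)) :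
    (pooledCov x y).IsSymm := by
  ext a b
  simp [pooledCov, mul_comm]

lemma quadForm_pooledCov (x : Fin N → EuclideanSpace ℝ (Fin p)) (y : Fin N → Fin (m + 1))
    (w : Fin p → ℝ) :
    w ⬝ᵥ pooledCov x y *ᵥ w = ((N : ℝ) - ((m : ℝ) + 1))⁻¹ *
      ∑ k, ∑ i with y i = k, (∑ a, w a * (x i a - classMean x y k a)) ^ 2 := by
  have e (k : Fin (m + 1)) (i : Fin N) : (∑ a, w a * (x i a - classMean x y k a)) ^ 2
      = ∑ a, ∑ b, w a * w b * ((x i a - classMean x y k a) * (x i b - classMean x y k b)) := by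
    rw [sq, Finset.sum_mul_sum]
    exact Finset.sum_congr rfl fun a _ => Finset.sum_congr rfl fun b _ => by ring
  simp only [e]
  have e2 (k : Fin (m + 1)) : ∑ i with y i = k, ∑ a, ∑ b, w a * w b *
        ((x i a - classMean x y k a) * (x i b - classMean x y k b))
      = ∑ a, ∑ b, ∑ i with y i = k, w a * w b *
        ((x i a - classMean x y k a) * (x i b - classMean x y k b)) := by
    rw [Finset.sum_comm]
    exact Finset.sum_congr rfl fun a _ => Finset.sum_comm
  simp only [e2]
  rw [Finset.sum_comm, Finset.mul_sum]
  simp only [dotProduct, mulVec, pooledCov, of_apply]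
  refine Finset.sum_congr rfl fun a _ => ?_
  rw [Finset.sum_comm, Finset.mul_sum, Finset.mul_sum]
  refine Finset.sum_congr rfl fun b _ => ?_
  simp only [Finset.mul_sum, Finset.sum_mul]
  exact Finset.sum_congr rfl fun k _ => Finset.sum_congr rfl fun i _ => by ring

lemma pooledCov_posSemidef (x : Fin N → EuclideanSpace ℝ (Fin p)) (y : Fin N → Fin (m + 1))
    (hN : m + 1 ≤ N) : (pooledCov x y).PosSemidef := by
  refine PosSemidef.of_dotProduct_mulVec_nonneg (by simpa using! pooledCov_isSymm x y) fun w => ?_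
  simp only [star_trivial]
  rw [quadForm_pooledCov]
  have : (0 : ℝ) ≤ (N : ℝ) - ((m : ℝ) + 1) := by
    have : ((m + 1 : ℕ) : ℝ) ≤ N := by exact_mod_cast hN
    push_cast at this
    linarith
  have h2 : 0 ≤ ∑ k, ∑ i with y i = k, (∑ a, w a * (x i a - classMean x y k a)) ^ 2 :=
    Finset.sum_nonneg fun k _ => Finset.sum_nonneg fun i _ => sq_nonneg _
  positivity

/-- The normalized sum of `z` over the class `k`. -/
noncomputable def classSum (y : Fin N → Fin (m + 1)) (z : Fin N → ℝ) (k : Fin (m + 1)) : ℝ :=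
  ∑ i, (if y i = k then (√(classCount y k))⁻¹ else 0) * z i

lemma classSum_eq (y : Fin N → Fin (m + 1)) (z : Fin N → ℝ) (k : Fin (m + 1)) :
    classSum y z k = (√(classCount y k))⁻¹ * ∑ i with y i = k, z i := by
  simp [classSum, Finset.mul_sum, Finset.sum_filter]

/-- Normalizing by the square root of the class size makes the weight vectors orthonormal, so the
class sums of independent standard Gaussians are again independent standard Gaussians. -/
lemma sum_classWeights {y : Fin N → Fin (m + 1)} (hn : ∀ k, 0 < classCount y k)
    (k l : Fin (m + 1)) :
    ∑ i, (if y i = k then (√(classCount y k))⁻¹ else 0)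
      * (if y i = l then (√(classCount y l))⁻¹ else 0) = if k = l then (1 : ℝ) else 0 := by
  split_ifs with h
  · subst h
    have h0 : (0 : ℝ) < classCount y k := by exact_mod_cast hn k
    have e (i : Fin N) : (if y i = k then (√(classCount y k))⁻¹ else 0)
      * (if y i = k then (√(classCount y k))⁻¹ else 0)
        = if y i = k then (classCount y k : ℝ)⁻¹ else 0 := by
      split_ifs
      · rw [← mul_inv, Real.mul_self_sqrt h0.le]
      · simp
    rw [Finset.sum_congr rfl fun i _ => e i, ← Finset.sum_filter, Finset.sum_const, nsmul_eq_mul]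
    exact mul_inv_cancel₀ h0.ne'
  · refine Finset.sum_eq_zero fun i _ => ?_
    by_cases hk : y i = k
    · have : y i ≠ l := fun hl => h (hk.symm.trans hl)
      simp [this]
    · simp [hk]

lemma sum_classMean_sub {x : Fin N → EuclideanSpace ℝ (Fin p)} {y : Fin N → Fin (m + 1)}
    (hn : ∀ k, 0 < classCount y k) (ν : Fin (m + 1) → EuclideanSpace ℝ (Fin p)) (w : Fin p → ℝ)
    (k : Fin (m + 1)) :
    ∑ a, w a * (classMean x y k a - ν k a)
      = (√(classCount y k))⁻¹ * classSum y (fun i => ∑ a, w a * (x i a - ν (y i) a)) k := by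
  have h0 : (0 : ℝ) < classCount y k := by exact_mod_cast hn k
  rw [classSum_eq, ← mul_assoc, ← mul_inv, Real.mul_self_sqrt h0.le, Finset.sum_comm,
    Finset.mul_sum]
  refine Finset.sum_congr rfl fun a _ => ?_
  rw [← Finset.mul_sum, mul_left_comm]
  congr 1
  have e : ∑ i with y i = k, (x i a - ν (y i) a)
      = ∑ i with y i = k, x i a - classCount y k * ν k a := by
    rw [Finset.sum_sub_distrib]
    congr 1
    rw [Finset.sum_congr rfl (g := fun _ => ν k a)]
    · simp [classCount]
    · intro i hi
      rw [(Finset.mem_filter.1 hi).2]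
  rw [e, mul_sub, ← mul_assoc, inv_mul_cancel₀ h0.ne', one_mul]
  simp [classMean]

/-- Decomposition of the within-class sum of squares. -/
lemma quadForm_pooledCov_eq {x : Fin N → EuclideanSpace ℝ (Fin p)} {y : Fin N → Fin (m + 1)}
    (hn : ∀ k, 0 < classCount y k) (ν : Fin (m + 1) → EuclideanSpace ℝ (Fin p)) (w : Fin p → ℝ) :
    w ⬝ᵥ pooledCov x y *ᵥ w = ((N : ℝ) - ((m : ℝ) + 1))⁻¹ *
      (∑ i, (∑ a, w a * (x i a - ν (y i) a)) ^ 2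
        - ∑ k, classSum y (fun i => ∑ a, w a * (x i a - ν (y i) a)) k ^ 2) := by
  rw [quadForm_pooledCov]
  congr 1
  rw [← Finset.sum_fiberwise (s := Finset.univ) y, ← Finset.sum_sub_distrib]
  refine Finset.sum_congr rfl fun k _ => ?_
  have h0 : (0 : ℝ) < classCount y k := by exact_mod_cast hn k
  set z : Fin N → ℝ := fun i => ∑ a, w a * (x i a - ν (y i) a) with hz
  set t := (√(classCount y k))⁻¹ * classSum y z k with ht
  have e1 : ∑ i with y i = k, (∑ a, w a * (x i a - classMean x y k a)) ^ 2
      = ∑ i with y i = k, (z i - t) ^ 2 := by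
    refine Finset.sum_congr rfl fun i hi => ?_
    rw [ht, ← sum_classMean_sub hn ν w k, hz]
    simp only
    rw [(Finset.mem_filter.1 hi).2, ← Finset.sum_sub_distrib]
    congr 1
    exact Finset.sum_congr rfl fun a _ => by ring
  have e2 : ∑ i with y i = k, z i = classCount y k * t := by
    rw [ht, classSum_eq, ← mul_assoc (√(classCount y k : ℝ))⁻¹, ← mul_inv,
      Real.mul_self_sqrt h0.le, ← mul_assoc, mul_inv_cancel₀ h0.ne', one_mul]
  have e3 : classSum y z k ^ 2 = classCount y k * t ^ 2 := by
    rw [ht, mul_pow, inv_pow, Real.sq_sqrt h0.le, ← mul_assoc, mul_inv_cancel₀ h0.ne', one_mul]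
  rw [e1, e3]
  have e4 (i : Fin N) : (z i - t) ^ 2 = z i ^ 2 - 2 * t * z i + t ^ 2 := by ring
  simp only [e4, Finset.sum_add_distrib, Finset.sum_sub_distrib, ← Finset.mul_sum, e2]
  rw [Finset.sum_const, nsmul_eq_mul]
  change _ + (classCount y k : ℝ) * t ^ 2 = _
  ring

end Sample

/-! ### Concentration for fixed labels. -/

section Concentration

lemma measureReal_le_add {Ω : Type*} [MeasurableSpace Ω] {Q : Measure Ω} [IsFiniteMeasure Q]
    {A B C : Set Ω} {a b : ℝ} (hA : Q.real A ≤ a) (hB : Q.real B ≤ b)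
    (h : ∀ ω ∈ C, ω ∈ A ∨ ω ∈ B) : Q.real C ≤ a + b :=
  ((measureReal_mono h (measure_ne_top Q _)).trans (measureReal_union_le A B)).trans
    (add_le_add hA hB)

variable {Ω : Type*} [MeasurableSpace Ω] {Q : Measure Ω} {m p N : ℕ}
  {μ : Fin (m + 1) → EuclideanSpace ℝ (Fin p)} {Sig : Matrix (Fin p) (Fin p) ℝ}
  {X : Fin N → Ω → EuclideanSpace ℝ (Fin p)} {y : Fin N → Fin (m + 1)}

lemma standardized (hS : Sig.PosDef) (hind : iIndepFun X Q) (hmeas : ∀ i, Measurable (X i))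
    (hlaw : ∀ i, HasLaw (X i) (multivariateGaussian (μ (y i)) Sig) Q) {w : Fin p → ℝ}
    (hw : w ≠ 0) :
    iIndepFun (fun i ω => (√(w ⬝ᵥ Sig *ᵥ w))⁻¹ * ∑ a, w a * (X i ω a - μ (y i) a)) Q ∧
    (∀ i, Measurable fun ω => (√(w ⬝ᵥ Sig *ᵥ w))⁻¹ * ∑ a, w a * (X i ω a - μ (y i) a)) ∧
    ∀ i, HasLaw (fun ω => (√(w ⬝ᵥ Sig *ᵥ w))⁻¹ * ∑ a, w a * (X i ω a - μ (y i) a))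
      (gaussianReal 0 1) Q := by
  refine ⟨?_, fun i => ?_, fun i => hasLaw_dotProduct hS _ (hlaw i) hw⟩
  · exact hind.comp (fun i x => (√(w ⬝ᵥ Sig *ᵥ w))⁻¹ * ∑ a, w a * (x a - μ (y i) a))
      fun i => by fun_prop
  · have := hmeas i
    fun_prop

lemma classMean_tail (hS : Sig.PosDef) (hind : iIndepFun X Q) (hmeas : ∀ i, Measurable (X i))
    (hlaw : ∀ i, HasLaw (X i) (multivariateGaussian (μ (y i)) Sig) Q)
    (hn : ∀ k, 0 < classCount y k) (k : Fin (m + 1)) (j : Fin p) {t : ℝ} (ht : 0 ≤ t) :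
    Q.real {ω | √(Sig j j / classCount y k) * t < |classMean (fun i => X i ω) y k j - μ k j|}
      ≤ 2 * Real.exp (-(t ^ 2 / 2)) := by
  have := hind.isProbabilityMeasure
  have h0 : (0 : ℝ) < classCount y k := by exact_mod_cast hn k
  set w : Fin p → ℝ := Pi.single j 1 with hw
  have hw0 : w ≠ 0 := by simp [hw]
  have hq : w ⬝ᵥ Sig *ᵥ w = Sig j j := by simp [hw, single_dotProduct]
  have hpos : 0 < Sig j j := hq ▸ quadForm_pos hS hw0
  obtain ⟨h1, h2, h3⟩ := standardized hS hind hmeas hlaw hw0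
  obtain ⟨-, hG⟩ := orthonormal_combination h1 h2 h3 _ (sum_classWeights hn)
  refine (measureReal_mono ?_ (measure_ne_top Q _)).trans (gaussian_tail (hG k) ht)
  intro ω hω
  simp only [Set.mem_ofPred_eq] at hω ⊢
  have e := sum_classMean_sub (x := fun i => X i ω) hn μ w k
  have e1 : ∑ a, w a * (classMean (fun i => X i ω) y k a - μ k a)
      = classMean (fun i => X i ω) y k j - μ k j := by
    simp [hw, Pi.single_apply]
  rw [← e1, e] at hω
  have e2 : ∑ i, (if y i = k then (√(classCount y k))⁻¹ else 0) *
      ((√(w ⬝ᵥ Sig *ᵥ w))⁻¹ * ∑ a, w a * (X i ω a - μ (y i) a))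
      = (√(Sig j j))⁻¹ * classSum y (fun i => ∑ a, w a * (X i ω a - μ (y i) a)) k := by
    rw [classSum, Finset.mul_sum, hq]
    exact Finset.sum_congr rfl fun i _ => by ring
  rw [e2, abs_mul, abs_of_nonneg (by positivity), inv_mul_eq_div, le_div_iff₀ (by positivity)]
  rw [abs_mul, abs_of_nonneg (by positivity), Real.sqrt_div hpos.le, inv_mul_eq_div,
    lt_div_iff₀ (by positivity)] at hω
  refine le_trans (le_of_eq ?_) hω.le
  field_simp

/-- The within-class sum of squares is the total sum of squares around the true means minus the
squared class sums. Both are chi-squared up to scale; their possible dependence is harmless, since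
each deviates by less than t outside its own bad event. -/
lemma quadForm_tail (hS : Sig.PosDef) (hind : iIndepFun X Q) (hmeas : ∀ i, Measurable (X i))
    (hlaw : ∀ i, HasLaw (X i) (multivariateGaussian (μ (y i)) Sig) Q)
    (hn : ∀ k, 0 < classCount y k) (hN : m + 1 < N) (w : Fin p → ℝ) {θ : ℝ} (hθ0 : 0 ≤ θ)
    (hθ : θ ≤ 1 / 4) (t : ℝ) :
    Q.real {ω | 2 * t / ((N : ℝ) - ((m : ℝ) + 1)) * (w ⬝ᵥ Sig *ᵥ w)
        < |w ⬝ᵥ pooledCov (fun i => X i ω) y *ᵥ w - w ⬝ᵥ Sig *ᵥ w|}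
      ≤ 4 * Real.exp (-θ * t + 2 * N * θ ^ 2) := by
  have := hind.isProbabilityMeasure
  have hNK : (0 : ℝ) < (N : ℝ) - ((m : ℝ) + 1) := by
    have : ((m + 1 : ℕ) : ℝ) < N := by exact_mod_cast hN
    push_cast at this
    linarith
  rcases eq_or_ne w 0 with rfl | hw
  · simp only [zero_dotProduct, mul_zero, sub_zero, abs_zero, lt_irrefl, Set.ofPred_false,
      measureReal_empty]
    positivity
  have hv := quadForm_pos hS hw
  set v := w ⬝ᵥ Sig *ᵥ w
  obtain ⟨h1, h2, h3⟩ := standardized hS hind hmeas hlaw hw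
  obtain ⟨g1, g3⟩ := orthonormal_combination h1 h2 h3 _ (sum_classWeights hn)
  have t1 := sum_sq_tail h1 h2 h3 hθ0 hθ (n := N) (by simp) t
  have t2 := sum_sq_tail g1 (fun k => by fun_prop) g3 hθ0 hθ (n := N)
    (by simpa using! (sub_pos.1 hNK).le) t
  refine (measureReal_le_add t1 t2 fun ω hω => ?_).trans (le_of_eq (by ring))
  by_contra! hcon
  obtain ⟨c1, c2⟩ := hcon
  simp only [Set.mem_ofPred_eq, not_le, Fintype.card_fin] at hω c1 c2
  push_cast at c2
  rw [quadForm_pooledCov_eq hn μ] at hω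
  have e1 : ∑ i, (∑ a, w a * (X i ω a - μ (y i) a)) ^ 2
      = v * ∑ i, ((√v)⁻¹ * ∑ a, w a * (X i ω a - μ (y i) a)) ^ 2 := by
    rw [Finset.mul_sum]
    refine Finset.sum_congr rfl fun i _ => ?_
    rw [mul_pow, inv_pow, Real.sq_sqrt hv.le, ← mul_assoc, mul_inv_cancel₀ hv.ne', one_mul]
  have e2 : ∑ k, classSum y (fun i => ∑ a, w a * (X i ω a - μ (y i) a)) k ^ 2
      = v * ∑ k, (∑ i, (if y i = k then (√(classCount y k))⁻¹ else 0) *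
        ((√v)⁻¹ * ∑ a, w a * (X i ω a - μ (y i) a))) ^ 2 := by
    rw [Finset.mul_sum]
    refine Finset.sum_congr rfl fun k _ => ?_
    have : ∑ i, (if y i = k then (√(classCount y k))⁻¹ else 0) *
        ((√v)⁻¹ * ∑ a, w a * (X i ω a - μ (y i) a))
        = (√v)⁻¹ * classSum y (fun i => ∑ a, w a * (X i ω a - μ (y i) a)) k := by
      rw [classSum, Finset.mul_sum]
      exact Finset.sum_congr rfl fun i _ => by ring
    rw [this, mul_pow, inv_pow, Real.sq_sqrt hv.le, ← mul_assoc, mul_inv_cancel₀ hv.ne', one_mul]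
  rw [e1, e2] at hω
  set z1 := ∑ i, ((√v)⁻¹ * ∑ a, w a * (X i ω a - μ (y i) a)) ^ 2
  set z2 := ∑ k, (∑ i, (if y i = k then (√(classCount y k))⁻¹ else 0) *
        ((√v)⁻¹ * ∑ a, w a * (X i ω a - μ (y i) a))) ^ 2
  have e3 : ((N : ℝ) - ((m : ℝ) + 1))⁻¹ * (v * z1 - v * z2) - v
      = v / ((N : ℝ) - ((m : ℝ) + 1)) * ((z1 - N) - (z2 - (m + 1))) := by
    field_simp
    ring
  rw [e3, abs_mul, abs_of_pos (by positivity)] at hω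
  have h5 : |(z1 - N) - (z2 - (m + 1))| < 2 * t := by
    refine (abs_sub _ _).trans_lt ?_
    linarith
  have h6 : v / ((N : ℝ) - ((m : ℝ) + 1)) * |(z1 - N) - (z2 - (m + 1))|
      < v / ((N : ℝ) - ((m : ℝ) + 1)) * (2 * t) := by gcongr
  have h7 : v / ((N : ℝ) - ((m : ℝ) + 1)) * (2 * t)
      = 2 * t / ((N : ℝ) - ((m : ℝ) + 1)) * v := by ring
  linarith

lemma bilinear_tail (hS : Sig.PosDef) (hind : iIndepFun X Q) (hmeas : ∀ i, Measurable (X i))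
    (hlaw : ∀ i, HasLaw (X i) (multivariateGaussian (μ (y i)) Sig) Q)
    (hn : ∀ k, 0 < classCount y k) (hN : m + 1 < N) (u v : Fin p → ℝ) {θ : ℝ} (hθ0 : 0 ≤ θ)
    (hθ : θ ≤ 1 / 4) (t : ℝ) :
    Q.real {ω | 2 * t / ((N : ℝ) - ((m : ℝ) + 1)) * (√(u ⬝ᵥ Sig *ᵥ u) * √(v ⬝ᵥ Sig *ᵥ v))
        < |u ⬝ᵥ pooledCov (fun i => X i ω) y *ᵥ v - u ⬝ᵥ Sig *ᵥ v|}
      ≤ 8 * Real.exp (-θ * t + 2 * N * θ ^ 2) := by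
  have := hind.isProbabilityMeasure
  have T (σ : ℝ) := quadForm_tail hS hind hmeas hlaw hn hN
    ((√(u ⬝ᵥ Sig *ᵥ u))⁻¹ • u + (σ * (√(v ⬝ᵥ Sig *ᵥ v))⁻¹) • v) hθ0 hθ t
  refine (measureReal_le_add (T 1) (T (-1)) fun ω hω => ?_).trans (le_of_eq (by ring))
  by_contra! hcon
  obtain ⟨c1, c2⟩ := hcon
  refine not_le.2 hω (bilinear_error_le (pooledCov_isSymm _ _) hS u v fun σ hσ => ?_)
  rcases eq_or_eq_neg_of_abs_eq hσ with rfl | rfl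
  · exact not_lt.1 c1
  · exact not_lt.1 c2

end Concentration

/-! ### Conditioning on the labels and the union bound. -/

section Conditioning

variable {Ω : Type*} [MeasurableSpace Ω] {P : Measure Ω} {m p N : ℕ} {π : Fin (m + 1) → ℝ}
  {μ : Fin (m + 1) → EuclideanSpace ℝ (Fin p)} {Sig : Matrix (Fin p) (Fin p) ℝ}
  {X : Fin N → Ω → EuclideanSpace ℝ (Fin p)} {Y : Fin N → Ω → Fin (m + 1)}

/-- The Bayes directions and the coordinate directions. -/
noncomputable def direction (μ : Fin (m + 1) → EuclideanSpace ℝ (Fin p))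
    (Sig : Matrix (Fin p) (Fin p) ℝ) : Fin m ⊕ Fin p → Fin p → ℝ :=
  Sum.elim (bayesDir μ Sig) fun i => Pi.single i 1

/-- The class sample means and the relevant entries of the pooled covariance are accurate, at
confidence level governed by `L`. -/
def Accurate (μ : Fin (m + 1) → EuclideanSpace ℝ (Fin p)) (Sig : Matrix (Fin p) (Fin p) ℝ) (L : ℝ)
    (x : Fin N → EuclideanSpace ℝ (Fin p)) (y : Fin N → Fin (m + 1)) : Prop :=
  (∀ q : Fin (m + 1) × Fin p,
    |classMean x y q.1 q.2 - μ q.1 q.2| ≤ √(Sig q.2 q.2 / classCount y q.1) * √(12 * L)) ∧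
  (48 * L ≤ N → ∀ q : Fin p × (Fin m ⊕ Fin p),
    |Pi.single q.1 1 ⬝ᵥ pooledCov x y *ᵥ direction μ Sig q.2
      - Pi.single q.1 1 ⬝ᵥ Sig *ᵥ direction μ Sig q.2|
    ≤ 2 * (4 * √(3 * L * N)) / ((N : ℝ) - ((m : ℝ) + 1))
      * (√(Pi.single q.1 1 ⬝ᵥ Sig *ᵥ Pi.single q.1 1)
        * √(direction μ Sig q.2 ⬝ᵥ Sig *ᵥ direction μ Sig q.2)))

lemma measureReal_exists_le {κ : Type*} [Fintype κ] {Q : Measure Ω} [IsFiniteMeasure Q]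
    {A : κ → Set Ω} {b : ℝ} (hA : ∀ k, Q.real (A k) ≤ b) :
    Q.real {ω | ∃ k, ω ∈ A k} ≤ Fintype.card κ * b := by
  have e : {ω | ∃ k, ω ∈ A k} = ⋃ k, A k := by ext; simp
  rw [e]
  refine (measureReal_iUnion_fintype_le _).trans ((Finset.sum_le_sum fun k _ => hA k).trans ?_)
  simp

lemma not_accurate_le {Q : Measure Ω} {y : Fin N → Fin (m + 1)} {L : ℝ} (hL : 0 ≤ L)
    (hS : Sig.PosDef) (hind : iIndepFun X Q) (hmeas : ∀ i, Measurable (X i))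
    (hlaw : ∀ i, HasLaw (X i) (multivariateGaussian (μ (y i)) Sig) Q)
    (hn : ∀ k, 0 < classCount y k) (hN : m + 1 < N) :
    Q.real {ω | ¬ Accurate μ Sig L (fun i => X i ω) y}
      ≤ (2 * ((m + 1) * p) + 8 * (p * (m + p))) * Real.exp (-(6 * L)) := by
  have := hind.isProbabilityMeasure
  have hN0 : (0 : ℝ) < N := by exact_mod_cast (Nat.zero_le _).trans_lt hN
  have h1 : Q.real {ω | ∃ q : Fin (m + 1) × Fin p, ω ∈ {ω |
      √(Sig q.2 q.2 / classCount y q.1) * √(12 * L)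
        < |classMean (fun i => X i ω) y q.1 q.2 - μ q.1 q.2|}}
      ≤ Fintype.card (Fin (m + 1) × Fin p) * (2 * Real.exp (-(6 * L))) := by
    refine measureReal_exists_le fun q => ?_
    refine (classMean_tail hS hind hmeas hlaw hn q.1 q.2 (Real.sqrt_nonneg _)).trans (le_of_eq ?_)
    rw [Real.sq_sqrt (by positivity)]
    ring_nf
  by_cases hLN : 48 * L ≤ N
  · have h2 : Q.real {ω | ∃ q : Fin p × (Fin m ⊕ Fin p), ω ∈ {ω |
        2 * (4 * √(3 * L * N)) / ((N : ℝ) - ((m : ℝ) + 1))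
          * (√(Pi.single q.1 1 ⬝ᵥ Sig *ᵥ Pi.single q.1 1)
            * √(direction μ Sig q.2 ⬝ᵥ Sig *ᵥ direction μ Sig q.2))
        < |Pi.single q.1 1 ⬝ᵥ pooledCov (fun i => X i ω) y *ᵥ direction μ Sig q.2
          - Pi.single q.1 1 ⬝ᵥ Sig *ᵥ direction μ Sig q.2|}}
        ≤ Fintype.card (Fin p × (Fin m ⊕ Fin p)) * (8 * Real.exp (-(6 * L))) := by
      refine measureReal_exists_le fun q => ?_
      -- This θ with t = 4√(3LN) makes the exponent −θt + 2Nθ² = −12L + 6L = −6L; the chi-squared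
      -- bound needs θ ≤ 1/4, which is exactly 48L ≤ N.
      have hθ : √(3 * L / N) ≤ 1 / 4 := by
        rw [Real.sqrt_le_left (by norm_num), div_le_iff₀ hN0]
        linarith
      refine (bilinear_tail hS hind hmeas hlaw hn hN _ _ (Real.sqrt_nonneg (3 * L / N)) hθ _).trans
        (le_of_eq ?_)
      have e1 : √(3 * L / N) * √(3 * L * N) = 3 * L := by
        rw [← Real.sqrt_mul (by positivity), ← Real.sqrt_mul_self (by positivity : 0 ≤ 3 * L)]
        congr 1
        rw [Real.sqrt_mul_self (by positivity)]
        field_simp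
      have e2 : √(3 * L / N) ^ 2 = 3 * L / N := Real.sq_sqrt (by positivity)
      have e3 : -√(3 * L / N) * (4 * √(3 * L * N)) + 2 * N * √(3 * L / N) ^ 2 = -(6 * L) := by
        rw [e2, show 2 * (N : ℝ) * (3 * L / N) = 6 * L by field_simp; ring]
        linear_combination (-4) * e1
      rw [e3]
    refine (measureReal_le_add h1 h2 fun ω hω => ?_).trans (le_of_eq ?_)
    · by_contra! hcon
      obtain ⟨c1, c2⟩ := hcon
      simp only [Set.mem_ofPred_eq, not_exists, not_lt] at c1 c2 hω
      exact hω ⟨c1, fun _ => c2⟩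
    · simp
      ring
  · refine (measureReal_mono (fun ω hω => ?_) (measure_ne_top Q _)).trans (h1.trans ?_)
    · by_contra! c1
      simp only [Set.mem_ofPred_eq, not_exists, not_lt] at c1 hω
      exact hω ⟨c1, fun h => absurd h hLN⟩
    · have : 0 ≤ 8 * ((p : ℝ) * (m + p)) * Real.exp (-(6 * L)) := by positivity
      simp
      linarith

/-- The pairs are independent, so conditioning on all labels affects each `X i` only through its own
label and keeps the `X i` independent. -/
lemma conditional_model (h : IsSample P π μ Sig X Y) (hπ : ∀ k, 0 < π k)
    (y : Fin N → Fin (m + 1)) :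
    iIndepFun X P[|(fun ω i => Y i ω) ⁻¹' {y}] ∧
      ∀ i, HasLaw (X i) (multivariateGaussian (μ (y i)) Sig) P[|(fun ω i => Y i ω) ⁻¹' {y}] := by
  have e : (fun ω i => Y i ω) ⁻¹' {y} = ⋂ i, Y i ⁻¹' {y i} := by
    ext ω; simp [funext_iff]
  have hne (i : Fin N) : P (Y i ⁻¹' {y i}) ≠ 0 := fun h0 => by
    have h1 := h.label_law i (y i)
    have h2 : P.real {ω | Y i ω = y i} = 0 := by
      rw [measureReal_def, show {ω | Y i ω = y i} = Y i ⁻¹' {y i} from rfl, h0]; rfl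
    linarith [hπ (y i)]
  rw [e]
  refine ⟨h.indep.cond h.measurable_Y hne fun _ => measurableSet_singleton _,
    fun i => ⟨(h.measurable_X i).aemeasurable, ?_⟩⟩
  ext A hA
  rw [← h.cond_law i (y i), Measure.map_apply (h.measurable_X i) hA,
    Measure.map_apply (h.measurable_X i) hA]
  have := cond_iInter (s := {i}) (f := fun j => X j ⁻¹' A) (t := fun i => {y i}) h.measurable_Y
    h.indep (fun j _ => ⟨A, hA, rfl⟩) (fun j _ => hne j) fun _ => measurableSet_singleton _
  simp only [Finset.mem_singleton, Set.iInter_iInter_eq_left, Finset.prod_singleton] at this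
  exact this

variable [IsProbabilityMeasure P]

lemma measureReal_le_of_cond_le {α : Type*} [Fintype α] [MeasurableSpace α]
    [DiscreteMeasurableSpace α] {V : Ω → α} (hV : Measurable V) {C : α → Set Ω} {b : ℝ}
    (h : ∀ v, (P[|V ⁻¹' {v}]).real (C v) ≤ b) : P.real {ω | ω ∈ C (V ω)} ≤ b := by
  have hb : 0 ≤ b := by
    have := nonempty_of_isProbabilityMeasure P
    exact measureReal_nonneg.trans (h (V this.some))
  refine ENNReal.toReal_le_of_le_ofReal hb ?_
  rw [← sum_meas_smul_cond_fiber hV P]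
  simp only [Measure.coe_finsetSum, Finset.sum_apply, Measure.coe_smul, Pi.smul_apply, smul_eq_mul]
  have key (v : α) : P[|V ⁻¹' {v}] {ω | ω ∈ C (V ω)} ≤ ENNReal.ofReal b := by
    have hm : MeasurableSet (V ⁻¹' {v}) := hV (measurableSet_singleton v)
    have e : P[|V ⁻¹' {v}] {ω | ω ∈ C (V ω)} ≤ P[|V ⁻¹' {v}] (C v) := by
      rw [← cond_inter_self hm {ω | ω ∈ C (V ω)}]
      refine measure_mono fun ω hω => ?_
      have h1 : V ω = v := hω.1
      have h2 : ω ∈ C (V ω) := hω.2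
      rwa [h1] at h2
    refine e.trans ?_
    rw [ENNReal.le_ofReal_iff_toReal_le (measure_ne_top _ _) hb]
    exact h v
  calc ∑ v, P (V ⁻¹' {v}) * P[|V ⁻¹' {v}] {ω | ω ∈ C (V ω)}
      ≤ ∑ v, P (V ⁻¹' {v}) * ENNReal.ofReal b := by gcongr with v; exact key v
    _ = ENNReal.ofReal b := by
        rw [← Finset.sum_mul, sum_measure_preimage_singleton _
          fun v _ => hV (measurableSet_singleton v)]
        simp

lemma classCount_tail (h : IsSample P π μ Sig X Y) (k : Fin (m + 1)) (hπ : 0 < π k) :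
    P.real {ω | (classCount (fun i => Y i ω) k : ℝ) ≤ N * π k / 2}
      ≤ Real.exp (-((N : ℝ) * π k / 16)) := by
  classical
  set W : Fin N → Ω → ℝ := fun i => {ω | Y i ω = k}.indicator 1 with hW
  have hms (i : Fin N) : MeasurableSet {ω | Y i ω = k} :=
    h.measurable_Y i (measurableSet_singleton k)
  have hmeas (i : Fin N) : Measurable (W i) := measurable_one.indicator (hms i)
  have hind : iIndepFun W P := by
    have := h.indep.comp (fun _ q => if q.2 = k then (1 : ℝ) else 0) fun i =>
      Measurable.ite (measurable_snd (measurableSet_singleton k)) measurable_const measurable_const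
    convert this using 2 with i
    ext ω
    simp [hW, Set.indicator_apply]
  -- Chernoff at parameter −1: on {0, 1} the exponential is affine with slope −c. The final exponent
  -- is Nπ_k(1/2 − c), so c ≥ 9/16 gives the 1/16.
  set c : ℝ := 1 - Real.exp (-1) with hc
  have hexp (i : Fin N) (ω : Ω) : Real.exp (-1 * W i ω) = 1 - c * W i ω := by
    by_cases hω : Y i ω = k <;> simp [hW, hω, hc]
  have hWint (i : Fin N) : Integrable (W i) P := (integrable_const (1 : ℝ)).indicator (hms i)
  have hint (i : Fin N) : Integrable (fun ω => Real.exp (-1 * W i ω)) P := by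
    simp only [hexp]
    exact (integrable_const _).sub ((hWint i).const_mul _)
  have hmgf (i : Fin N) : mgf (W i) P (-1) ≤ Real.exp (-(c * π k)) := by
    rw [mgf]
    simp only [hexp]
    rw [integral_sub (integrable_const _) ((hWint i).const_mul _), integral_const_mul,
      integral_indicator_one (hms i), h.label_law]
    have := Real.add_one_le_exp (-(c * π k))
    simp
    linarith
  have hsum (ω : Ω) : (classCount (fun i => Y i ω) k : ℝ) = (∑ i, W i) ω := by
    simp [classCount, hW, Set.indicator_apply]
  have hI := hind.integrable_exp_mul_sum (t := -1) hmeas (s := Finset.univ) fun i _ => hint i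
  have hT := measure_le_le_exp_mul_mgf (X := ∑ i, W i) (N * π k / 2) (by norm_num) hI
  simp only [hsum]
  refine hT.trans ?_
  rw [hind.mgf_sum hmeas]
  have hprod : ∏ i, mgf (W i) P (-1) ≤ Real.exp (N * -(c * π k)) := by
    rw [Real.exp_nat_mul]
    calc _ ≤ ∏ _i : Fin N, Real.exp (-(c * π k)) :=
          Finset.prod_le_prod (fun _ _ => mgf_nonneg) fun i _ => hmgf i
      _ = _ := by simp
  refine (mul_le_mul_of_nonneg_left hprod (Real.exp_pos _).le).trans ?_
  rw [← Real.exp_add, Real.exp_le_exp]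
  have hc2 : 9 / 16 ≤ c := by
    have h1 := Real.exp_one_gt_d9
    have h2 : Real.exp (-1) ≤ 7 / 16 := by
      rw [Real.exp_neg, inv_le_comm₀ (Real.exp_pos _) (by norm_num)]
      linarith
    linarith
  have : (0 : ℝ) ≤ N * π k := by positivity
  nlinarith

lemma sum_label_law (h : IsSample P π μ Sig X Y) (hN : 0 < N) : ∑ k, π k = 1 := by
  have hs := sum_measureReal_preimage_singleton (μ := P) (f := Y ⟨0, hN⟩) Finset.univ
    (fun k _ => h.measurable_Y _ (measurableSet_singleton k))
  rw [Finset.coe_univ, Set.preimage_univ, probReal_univ] at hs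
  rw [← hs]
  exact Finset.sum_congr rfl fun k _ => (h.label_law ⟨0, hN⟩ k).symm

/-- With high probability, all classes are well represented and the statistics are accurate. -/
lemma not_good_le (h : IsSample P π μ Sig X Y) (hπ : ∀ k, 0 < π k) (hS : Sig.PosDef)
    (hN : m + 1 < N) (hm : 1 ≤ m) :
    P.real {ω | ¬ ((∀ k, N * π k / 2 ≤ classCount (fun i => Y i ω) k) ∧
      Accurate μ Sig (Real.log (max (p : ℝ) (N : ℝ))) (fun i => X i ω) fun i => Y i ω)}
    ≤ ∑ k, Real.exp (-((N : ℝ) * π k / 16)) + 2 / max (p : ℝ) (N : ℝ) := by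
  classical
  set M := max (p : ℝ) (N : ℝ) with hM
  have hpM : (p : ℝ) ≤ M := le_max_left _ _
  have hNM : (N : ℝ) ≤ M := le_max_right _ _
  have hN3 : (3 : ℝ) ≤ N := by exact_mod_cast (by omega : 3 ≤ N)
  have hM3 : 3 ≤ M := hN3.trans hNM
  have hM0 : 0 < M := by linarith
  have hmM : (m : ℝ) + 1 ≤ M := by
    have : ((m + 1 : ℕ) : ℝ) ≤ N := by exact_mod_cast hN.le
    push_cast at this
    linarith
  have hL : 0 ≤ Real.log M := Real.log_nonneg (by linarith)
  have hexp : Real.exp (-(6 * Real.log M)) = (M ^ 6)⁻¹ := by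
    rw [Real.exp_neg, show (6 : ℝ) * Real.log M = ((6 : ℕ) : ℝ) * Real.log M by norm_num,
      Real.exp_nat_mul, Real.exp_log hM0]
  set C : (Fin N → Fin (m + 1)) → Set Ω := fun y => {ω | (∀ k, N * π k / 2 ≤ classCount y k) ∧
    ¬ Accurate μ Sig (Real.log M) (fun i => X i ω) y} with hC
  have h1 : P.real {ω | ω ∈ C (fun i => Y i ω)} ≤ 2 / M := by
    refine measureReal_le_of_cond_le (V := fun ω i => Y i ω)
      (measurable_pi_lambda _ h.measurable_Y) fun y => ?_
    by_cases hy : ∀ k, N * π k / 2 ≤ classCount y k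
    · obtain ⟨hind, hlaw⟩ := conditional_model h hπ y
      have := hind.isProbabilityMeasure
      have hn (k : Fin (m + 1)) : 0 < classCount y k := by
        have h2 := hy k
        have h3 : (0 : ℝ) < N * π k / 2 := by have := hπ k; positivity
        exact_mod_cast h3.trans_le h2
      have h2 := not_accurate_le hL hS hind h.measurable_X hlaw hn hN
      refine (measureReal_mono (fun ω hω => hω.2) (measure_ne_top _ _)).trans (h2.trans ?_)
      rw [hexp, ← div_eq_mul_inv, div_le_div_iff₀ (by positivity) hM0]
      have e1 : ((m : ℝ) + 1) * p ≤ M * M := by gcongr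
      have e2 : (p : ℝ) * (m + p) ≤ M * (M + M) := by gcongr; linarith
      have e3 : (9 : ℝ) ≤ M ^ 3 := by nlinarith [pow_le_pow_left₀ (by norm_num) hM3 3]
      calc (2 * (((m : ℝ) + 1) * p) + 8 * (p * (m + p))) * M
          ≤ (2 * (M * M) + 8 * (M * (M + M))) * M := by gcongr
        _ = 2 * M ^ 3 * 9 := by ring
        _ ≤ 2 * M ^ 3 * M ^ 3 := by gcongr
        _ = 2 * M ^ 6 := by ring
    · have : C y = ∅ := by
        ext ω
        simp [hC, hy]
      rw [this, measureReal_empty]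
      positivity
  have h2 : P.real (⋃ k, {ω | (classCount (fun i => Y i ω) k : ℝ) ≤ N * π k / 2})
      ≤ ∑ k, Real.exp (-((N : ℝ) * π k / 16)) :=
    (measureReal_iUnion_fintype_le _).trans
      (Finset.sum_le_sum fun k _ => classCount_tail h k (hπ k))
  refine measureReal_le_add h2 h1 fun ω hω => ?_
  by_cases hg : ∀ k, N * π k / 2 ≤ classCount (fun i => Y i ω) k
  · exact Or.inr ⟨hg, fun ha => hω ⟨hg, ha⟩⟩
  · push Not at hg
    obtain ⟨k, hk⟩ := hg
    exact Or.inl (Set.mem_iUnion.2 ⟨k, hk.le⟩)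

end Conditioning

/-! ### Population quantities and rates. -/

section Population

variable {m p N : ℕ} {π : Fin (m + 1) → ℝ} {μ : Fin (m + 1) → EuclideanSpace ℝ (Fin p)}
  {Sig : Matrix (Fin p) (Fin p) ℝ}

lemma diagMin_le (A : Matrix (Fin p) (Fin p) ℝ) (j : Fin p) : diagMin A ≤ A j j :=
  ciInf_le (Set.finite_range _).bddBelow j

lemma le_diagMax (A : Matrix (Fin p) (Fin p) ℝ) (j : Fin p) : A j j ≤ diagMax A :=
  le_ciSup (f := fun j => A j j) (Set.finite_range _).bddAbove j

lemma abs_le_offDiagMax (A : Matrix (Fin p) (Fin p) ℝ) {i j : Fin p} (h : i ≠ j) :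
    |A i j| ≤ offDiagMax A :=
  le_ciSup (f := fun q : {q : Fin p × Fin p // q.1 ≠ q.2} => |A q.1.1 q.1.2|)
    (Set.finite_range _).bddAbove ⟨(i, j), h⟩

lemma diagMin_pos (hS : Sig.PosDef) (hp : 1 ≤ p) : 0 < diagMin Sig := by
  have : Nonempty (Fin p) := ⟨⟨0, hp⟩⟩
  obtain ⟨j, hj⟩ := exists_eq_ciInf_of_finite (f := fun j => Sig j j)
  rw [diagMin, ← hj]
  exact hS.diag_pos

lemma le_piBar (π : Fin (m + 1) → ℝ) (k : Fin m) :
    (π 0 + π k.succ) / (π 0 * π k.succ) ≤ piBar π :=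
  le_ciSup (f := fun k : Fin m => (π 0 + π k.succ) / (π 0 * π k.succ))
    (Set.finite_range _).bddAbove k

lemma inv_add_inv_le_piBar (hπ : ∀ k, 0 < π k) (k : Fin m) :
    (π 0)⁻¹ + (π k.succ)⁻¹ ≤ piBar π := by
  refine le_trans (le_of_eq ?_) (le_piBar π k)
  have := (hπ 0).ne'
  have := (hπ k.succ).ne'
  field_simp
  ring

lemma one_le_piBar (hπ : ∀ k, 0 < π k) (hsum : ∑ k, π k = 1) (hm : 1 ≤ m) : 1 ≤ piBar π := by
  have h0 : π 0 ≤ 1 := hsum ▸ Finset.single_le_sum (fun k _ => (hπ k).le) (Finset.mem_univ 0)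
  have h1 := inv_add_inv_le_piBar hπ ⟨0, hm⟩
  have h2 : 1 ≤ (π 0)⁻¹ := (one_le_inv₀ (hπ 0)).2 h0
  have h3 := inv_pos.2 (hπ (Fin.succ ⟨0, hm⟩))
  linarith

lemma mulVec_bayesDir (hS : Sig.PosDef) (k : Fin m) : Sig *ᵥ bayesDir μ Sig k = delta μ k := by
  rw [bayesDir, mulVec_mulVec, mul_nonsing_inv _ ((isUnit_iff_isUnit_det _).1 hS.isUnit),
    one_mulVec]

lemma signal_eq (hS : Sig.PosDef) :
    signal μ Sig = ∑ k, bayesDir μ Sig k ⬝ᵥ Sig *ᵥ bayesDir μ Sig k := by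
  simp only [mulVec_bayesDir hS]
  rfl

/-- The stochastic error rate `√(π̄ Σ⁺_max (Δ ∨ K) L / (N - K))`. -/
noncomputable def rate (π : Fin (m + 1) → ℝ) (μ : Fin (m + 1) → EuclideanSpace ℝ (Fin p))
    (Sig : Matrix (Fin p) (Fin p) ℝ) (N : ℕ) (L : ℝ) : ℝ :=
  √(piBar π * diagMax Sig * max (signal μ Sig) ((m : ℝ) + 1) * L / ((N : ℝ) - ((m : ℝ) + 1)))

lemma tuning_eq (C₀ L : ℝ) : tuning C₀ π μ Sig N (4 * L) = 4 * C₀ * rate π μ Sig N L := by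
  rw [tuning, rate, show ∀ A n : ℝ, A * (4 * L) / n = 2 ^ 2 * (A * L / n) by intros; ring,
    Real.sqrt_mul (by norm_num), Real.sqrt_sq (by norm_num)]
  ring

lemma diagMin_le_diagMax (A : Matrix (Fin p) (Fin p) ℝ) (hp : 1 ≤ p) : diagMin A ≤ diagMax A :=
  (diagMin_le A ⟨0, hp⟩).trans (le_diagMax A ⟨0, hp⟩)

lemma tuning_pos (hS : Sig.PosDef) (hπ : ∀ k, 0 < π k) (hsum : ∑ k, π k = 1) (hm : 1 ≤ m)
    (hp : 1 ≤ p) {L : ℝ} (hL : 0 < L) (hN : 0 < (N : ℝ) - ((m : ℝ) + 1)) :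
    0 < tuning 14 π μ Sig N (4 * L) := by
  have hpi := one_le_piBar hπ hsum hm
  have h1 : 0 < max (signal μ Sig) ((m : ℝ) + 1) := lt_max_of_lt_right (by positivity)
  have h2 : 0 < diagMax Sig := (diagMin_pos hS hp).trans_le (diagMin_le_diagMax Sig hp)
  have hr : 0 < rate π μ Sig N L := Real.sqrt_pos.2 (by positivity)
  rw [tuning_eq]
  positivity

lemma errorLevel_eq (C₀ C₂ : ℝ) (ha : 0 < diagMin Sig) :
    errorLevel C₀ C₂ π μ Sig N
      = C₂ * (4 * C₀ * rate π μ Sig N (Real.log (max (p : ℝ) (N : ℝ)))) / diagMin Sig := by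
  rw [errorLevel, rate, mul_comm (diagMin Sig ^ 2), ← div_div, Real.sqrt_div' _ (sq_nonneg _),
    Real.sqrt_sq ha.le]
  ring

end Population

/-! ### Consequences of accurate statistics. -/

section GoodEvent

variable {m p N : ℕ} {π : Fin (m + 1) → ℝ} {μ : Fin (m + 1) → EuclideanSpace ℝ (Fin p)}
  {Sig : Matrix (Fin p) (Fin p) ℝ} {L : ℝ} {x : Fin N → EuclideanSpace ℝ (Fin p)}
  {y : Fin N → Fin (m + 1)}

lemma norm_group_le {F : Fin m → Fin p → ℝ} {j : Fin p} {c : ℝ} (hc : 0 ≤ c)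
    (h : ∑ k, F k j ^ 2 ≤ c ^ 2) : ‖group F j‖ ≤ c := by
  rw [← abs_of_nonneg hc, ← abs_norm, ← sq_le_sq, EuclideanSpace.real_norm_sq_eq]
  exact h

lemma delta_classMean_error (hS : Sig.PosDef) (hπ : ∀ k, 0 < π k) (hL : 0 ≤ L) (hN : 0 < N)
    (hcount : ∀ k, N * π k / 2 ≤ classCount y k) (hacc : Accurate μ Sig L x y)
    (k : Fin m) (j : Fin p) :
    (delta (classMean x y) k j - delta μ k j) ^ 2 ≤ 48 * (piBar π * diagMax Sig * L / N) := by
  have hN0 : (0 : ℝ) < N := by exact_mod_cast hN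
  have hmean (l : Fin (m + 1)) :
      (classMean x y l j - μ l j) ^ 2 ≤ 24 * (diagMax Sig * L / N) * (π l)⁻¹ := by
    have hjj : 0 < Sig j j := hS.diag_pos
    have hn : (0 : ℝ) < classCount y l := lt_of_lt_of_le (by have := hπ l; positivity) (hcount l)
    have h1 := hacc.1 (l, j)
    rw [← abs_of_nonneg (by positivity : 0 ≤ √(Sig j j / classCount y l) * √(12 * L)),
      ← sq_le_sq, mul_pow, Real.sq_sqrt (by positivity), Real.sq_sqrt (by positivity)] at h1
    refine h1.trans ?_
    have h2 : Sig j j / classCount y l ≤ diagMax Sig / (N * π l / 2) := by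
      have := hπ l
      gcongr
      · exact hjj.le.trans (le_diagMax Sig j)
      · exact le_diagMax Sig j
      · exact hcount l
    calc Sig j j / classCount y l * (12 * L) ≤ diagMax Sig / (N * π l / 2) * (12 * L) := by gcongr
      _ = _ := by have := (hπ l).ne'; field_simp; ring
  have e : delta (classMean x y) k j - delta μ k j
      = (classMean x y 0 j - μ 0 j) - (classMean x y k.succ j - μ k.succ j) := by
    simp only [delta]; ring
  have hd : 0 ≤ diagMax Sig * L / N := by
    have := (hS.diag_pos (i := j)).le.trans (le_diagMax Sig j)
    positivity
  rw [e]
  calc _ ≤ 2 * (classMean x y 0 j - μ 0 j) ^ 2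
        + 2 * (classMean x y k.succ j - μ k.succ j) ^ 2 := by
        linarith [sq_nonneg ((classMean x y 0 j - μ 0 j)
          + (classMean x y k.succ j - μ k.succ j))]
    _ ≤ 48 * (diagMax Sig * L / N) * ((π 0)⁻¹ + (π k.succ)⁻¹) := by
        linarith [hmean 0, hmean k.succ]
    _ ≤ 48 * (diagMax Sig * L / N) * piBar π := by
        gcongr
        exact inv_add_inv_le_piBar hπ k
    _ = _ := by ring

lemma pooledCov_error_sq (hS : Sig.PosDef) (hL : 0 ≤ L)
    (hN : (N : ℝ) ≤ 2 * ((N : ℝ) - ((m : ℝ) + 1))) (hN0 : 0 < N) (hLN : 48 * L ≤ N)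
    (hacc : Accurate μ Sig L x y) (j : Fin p) (c : Fin m ⊕ Fin p) :
    ((pooledCov x y *ᵥ direction μ Sig c) j - (Sig *ᵥ direction μ Sig c) j) ^ 2
      ≤ 384 * (diagMax Sig * L / ((N : ℝ) - ((m : ℝ) + 1)))
        * (direction μ Sig c ⬝ᵥ Sig *ᵥ direction μ Sig c) := by
  have hN0' : (0 : ℝ) < N := by exact_mod_cast hN0
  set n := (N : ℝ) - ((m : ℝ) + 1) with hn
  have hn0 : 0 < n := by linarith
  have h1 := hacc.2 hLN (j, c)
  simp only [single_one_dotProduct, mulVec_single_one, col_apply] at h1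
  have hjj : 0 < Sig j j := hS.diag_pos
  have hq : 0 ≤ direction μ Sig c ⬝ᵥ Sig *ᵥ direction μ Sig c := quadForm_nonneg hS.posSemidef _
  set q := direction μ Sig c ⬝ᵥ Sig *ᵥ direction μ Sig c
  rw [← hn] at h1
  rw [← abs_of_nonneg (by positivity :
      0 ≤ 2 * (4 * √(3 * L * N)) / n * (√(Sig j j) * √q)), ← sq_le_sq] at h1
  refine h1.trans ?_
  rw [mul_pow, mul_pow (√(Sig j j)), Real.sq_sqrt hjj.le, Real.sq_sqrt hq, div_pow, mul_pow,
    mul_pow 4, Real.sq_sqrt (by positivity), ← mul_assoc]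
  refine mul_le_mul_of_nonneg_right ?_ hq
  calc 2 ^ 2 * (4 ^ 2 * (3 * L * N)) / n ^ 2 * Sig j j
      ≤ 2 ^ 2 * (4 ^ 2 * (3 * L * (2 * n))) / n ^ 2 * diagMax Sig := by
        gcongr
        exact le_diagMax Sig j
    _ = _ := by field_simp; ring

/-- The mean part has squared norm at most 48r² ≤ (7r)² and the covariance part at most 384r² ≤
(20r)², where r is the rate. As λ/2 = 28r when C₀ = 14, the total 27r lies below half the penalty.
-/
lemma noise_le (hS : Sig.PosDef) (hπ : ∀ k, 0 < π k) (hsum : ∑ k, π k = 1) (hm : 1 ≤ m)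
    (hL : 0 ≤ L) (hN : (N : ℝ) ≤ 2 * ((N : ℝ) - ((m : ℝ) + 1))) (hN0 : 0 < N)
    (hcount : ∀ k, N * π k / 2 ≤ classCount y k) (hacc : Accurate μ Sig L x y)
    (hLN : (∀ k, bayesDir μ Sig k = 0) ∨ 48 * L ≤ N) (j : Fin p) :
    ‖group (fun k => pooledCov x y *ᵥ bayesDir μ Sig k - delta (classMean x y) k) j‖
      ≤ 27 * rate π μ Sig N L := by
  have hN0' : (0 : ℝ) < N := by exact_mod_cast hN0
  have hD0 : 0 < diagMax Sig := (hS.diag_pos (i := j)).trans_le (le_diagMax Sig j)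
  have hpi := one_le_piBar hπ hsum hm
  have hsig : 0 ≤ signal μ Sig := by
    rw [signal_eq hS]
    exact Finset.sum_nonneg fun k _ => quadForm_nonneg hS.posSemidef _
  have hn0 : 0 < (N : ℝ) - ((m : ℝ) + 1) := by linarith
  have hnN : (N : ℝ) - ((m : ℝ) + 1) ≤ N := by linarith [Nat.cast_nonneg (α := ℝ) m]
  have hrate : rate π μ Sig N L ^ 2 = piBar π * diagMax Sig * max (signal μ Sig) ((m : ℝ) + 1)
      * L / ((N : ℝ) - ((m : ℝ) + 1)) := by
    rw [rate, Real.sq_sqrt]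
    positivity
  have hr0 : 0 ≤ rate π μ Sig N L := Real.sqrt_nonneg _
  set n := (N : ℝ) - ((m : ℝ) + 1)
  set r := rate π μ Sig N L
  set U : Fin m → Fin p → ℝ :=
    fun k => pooledCov x y *ᵥ bayesDir μ Sig k - Sig *ᵥ bayesDir μ Sig k with hU
  set V : Fin m → Fin p → ℝ := fun k => delta (classMean x y) k - delta μ k with hV
  have e : (fun k => pooledCov x y *ᵥ bayesDir μ Sig k - delta (classMean x y) k) = U - V := by
    ext k i
    simp [hU, hV, mulVec_bayesDir hS]
  have hVle : ‖group V j‖ ≤ 7 * r := by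
    refine norm_group_le (by positivity) ?_
    calc ∑ k, V k j ^ 2 ≤ ∑ _k : Fin m, 48 * (piBar π * diagMax Sig * L / N) :=
          Finset.sum_le_sum fun k _ => delta_classMean_error hS hπ hL hN0 hcount hacc k j
      _ = m * (48 * (piBar π * diagMax Sig * L / N)) := by simp
      _ ≤ max (signal μ Sig) ((m : ℝ) + 1) * (48 * (piBar π * diagMax Sig * L / n)) := by
          gcongr
          exact le_trans (by linarith) (le_max_right _ _)
      _ = 48 * r ^ 2 := by rw [hrate]; ring
      _ ≤ (7 * r) ^ 2 := by linarith [sq_nonneg r]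
  have hUle : ‖group U j‖ ≤ 20 * r := by
    refine norm_group_le (by positivity) ?_
    rcases hLN with h0 | hLN
    · simp only [hU, h0, mulVec_zero, sub_zero, Pi.zero_apply]
      simp
      positivity
    calc ∑ k, U k j ^ 2
        ≤ ∑ k, 384 * (diagMax Sig * L / n)
          * (bayesDir μ Sig k ⬝ᵥ Sig *ᵥ bayesDir μ Sig k) :=
          Finset.sum_le_sum fun k _ => pooledCov_error_sq hS hL hN hN0 hLN hacc j (Sum.inl k)
      _ = 384 * (diagMax Sig * L / n) * signal μ Sig := by rw [← Finset.mul_sum, signal_eq hS]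
      _ ≤ 384 * (diagMax Sig * L / n) * (piBar π * max (signal μ Sig) ((m : ℝ) + 1)) := by
          gcongr
          calc signal μ Sig ≤ 1 * max (signal μ Sig) ((m : ℝ) + 1) := by
                rw [one_mul]; exact le_max_left _ _
            _ ≤ _ := by gcongr
      _ = 384 * r ^ 2 := by rw [hrate]; ring
      _ ≤ (20 * r) ^ 2 := by linarith [sq_nonneg r]
  rw [e, group_sub]
  exact (norm_sub_le _ _).trans (by linarith)

lemma pooledCov_entry_error (hS : Sig.PosDef) (hL : 0 ≤ L)
    (hN : (N : ℝ) ≤ 2 * ((N : ℝ) - ((m : ℝ) + 1))) (hN0 : 0 < N) (hLN : 48 * L ≤ N)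
    (hacc : Accurate μ Sig L x y) {a s : ℝ} (ha : 0 < a) (hs : 0 < s)
    (hsize : 1280 ^ 2 * (diagMax Sig / a) ^ 2 * s ^ 2 * L ≤ (N : ℝ) - ((m : ℝ) + 1))
    (i j : Fin p) : |pooledCov x y i j - Sig i j| ≤ a / (64 * s) := by
  have hN0' : (0 : ℝ) < N := by exact_mod_cast hN0
  have hD0 : 0 < diagMax Sig := (hS.diag_pos (i := j)).trans_le (le_diagMax Sig j)
  have h1 := pooledCov_error_sq hS hL hN hN0 hLN hacc i (Sum.inr j)
  simp only [direction, Sum.elim_inr, mulVec_single_one, col_apply, single_one_dotProduct] at h1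
  set n := (N : ℝ) - ((m : ℝ) + 1)
  have hn0 : 0 < n := by linarith
  rw [← abs_of_nonneg (by positivity : 0 ≤ a / (64 * s)), ← sq_le_sq]
  refine h1.trans ?_
  calc 384 * (diagMax Sig * L / n) * Sig j j
      ≤ 384 * (diagMax Sig * L / n) * diagMax Sig := by
        gcongr
        exact le_diagMax Sig j
    _ ≤ (a / (64 * s)) ^ 2 := by
        have e1 : 384 * (diagMax Sig * L / n) * diagMax Sig = 384 * diagMax Sig ^ 2 * L / n := by
          ring
        rw [e1, div_pow, div_le_div_iff₀ hn0 (by positivity)]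
        have e2 : 1280 ^ 2 * (diagMax Sig / a) ^ 2 * s ^ 2 * L * a ^ 2
            = 1280 ^ 2 * (diagMax Sig ^ 2 * s ^ 2 * L) := by
          field_simp
        have h2 := mul_le_mul_of_nonneg_right hsize (sq_nonneg a)
        rw [e2] at h2
        have h3 : 0 ≤ diagMax Sig ^ 2 * s ^ 2 * L := by positivity
        -- The choice C₃ = 1280² comes from 384 · 64² = 1572864 ≤ 1280².
        calc 384 * diagMax Sig ^ 2 * L * (64 * s) ^ 2
            = 1572864 * (diagMax Sig ^ 2 * s ^ 2 * L) := by ring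
          _ ≤ 1280 ^ 2 * (diagMax Sig ^ 2 * s ^ 2 * L) := by gcongr; norm_num
          _ ≤ n * a ^ 2 := h2
          _ = a ^ 2 * n := mul_comm _ _

/-- On the good event the estimator exists and every estimate is close to the Bayes directions. -/
lemma estimate_of_good (hS : Sig.PosDef) (hπ : ∀ k, 0 < π k) (hsum : ∑ k, π k = 1) (hm : 1 ≤ m)
    (hp : 1 ≤ p) (hL : 0 < L) (hN : (N : ℝ) ≤ 2 * ((N : ℝ) - ((m : ℝ) + 1))) (hN0 : 0 < N)
    (hcount : ∀ k, N * π k / 2 ≤ classCount y k) (hacc : Accurate μ Sig L x y)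
    (hoff : 128 * (sparsity μ Sig : ℝ) * offDiagMax Sig ≤ diagMin Sig)
    (hsize : ((m : ℝ) + 1) + 1280 ^ 2 * (diagMax Sig / diagMin Sig) ^ 2
      * (sparsity μ Sig : ℝ) ^ 2 * L ≤ N) :
    (∃ B, IsEstimate x y (fun _ => tuning 14 π μ Sig N (4 * L)) B) ∧
      ∀ B, IsEstimate x y (fun _ => tuning 14 π μ Sig N (4 * L)) B → ∀ j,
        ‖group (B - bayesDir μ Sig) j‖ ≤ 4 * tuning 14 π μ Sig N (4 * L) / diagMin Sig := by
  classical
  have hN0' : (0 : ℝ) < N := by exact_mod_cast hN0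
  have ha := diagMin_pos hS hp
  have hn0 : 0 < (N : ℝ) - ((m : ℝ) + 1) := by linarith
  have haD := diagMin_le_diagMax Sig hp
  have hl := tuning_pos (μ := μ) hS hπ hsum hm hp hL hn0
  set T : Finset (Fin p) := (⋃ k : Fin m, Function.support (bayesDir μ Sig k)).toFinset with hTdef
  have hTcard : sparsity μ Sig = T.card := by rw [sparsity, Set.ncard_eq_toFinset_card']
  have hT : ∀ j ∉ T, ∀ k, bayesDir μ Sig k j = 0 := by
    intro j hj k
    by_contra hne
    exact hj (Set.mem_toFinset.2 (Set.mem_iUnion.2 ⟨k, hne⟩))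
  rw [hTcard] at hoff hsize
  -- The sample size condition controls log(p ∨ N) only if s ≥ 1. For s = 0 all β_k vanish and no
  -- accuracy of S is needed.
  have hLN (hne : T.Nonempty) : 48 * L ≤ N := by
    have hs : (1 : ℝ) ≤ T.card := by exact_mod_cast hne.card_pos
    have hq : 1 ≤ diagMax Sig / diagMin Sig := (one_le_div ha).2 haD
    have : (1 : ℝ) * L ≤ (diagMax Sig / diagMin Sig) ^ 2 * (T.card : ℝ) ^ 2 * L := by
      gcongr
      exact one_le_mul_of_one_le_of_one_le (one_le_pow₀ hq) (one_le_pow₀ hs)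
    have := Nat.cast_nonneg (α := ℝ) m
    linarith
  have hentry (hne : T.Nonempty) (i j : Fin p) :
      |pooledCov x y i j - Sig i j| ≤ diagMin Sig / (64 * T.card) := by
    have hs : (0 : ℝ) < T.card := by exact_mod_cast hne.card_pos
    exact pooledCov_entry_error hS hL.le hN hN0 (hLN hne) hacc ha hs (by linarith) i j
  have hpsd := pooledCov_posSemidef x y
    (by exact_mod_cast (sub_pos.1 hn0).le : m + 1 ≤ N)
  have hW (j : Fin p) :
      ‖group (fun k => pooledCov x y *ᵥ bayesDir μ Sig k - delta (classMean x y) k) j‖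
      ≤ tuning 14 π μ Sig N (4 * L) / 2 := by
    have hcase : (∀ k, bayesDir μ Sig k = 0) ∨ 48 * L ≤ N := by
      rcases T.eq_empty_or_nonempty with h0 | hne
      · left
        intro k
        ext j
        exact hT j (by simp [h0]) k
      · exact Or.inr (hLN hne)
    have := noise_le hS hπ hsum hm hL.le hN hN0 hcount hacc hcase j
    have hr : 0 ≤ rate π μ Sig N L := Real.sqrt_nonneg _
    rw [tuning_eq]
    linarith
  refine ⟨exists_minimizer hpsd hl hW, fun B hB j =>
    norm_error_le hpsd hl hW T hT ha (fun hne j => ?_) (fun hne i j hij => ?_) hB j⟩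
  · have hs : (1 : ℝ) ≤ T.card := by exact_mod_cast hne.card_pos
    have h1 := (abs_le.1 (hentry hne j j)).1
    have h2 := diagMin_le Sig j
    have h3 : diagMin Sig / (64 * T.card) ≤ diagMin Sig / 2 := by
      gcongr
      linarith
    linarith
  · have hs : (0 : ℝ) < T.card := by exact_mod_cast hne.card_pos
    have h1 := hentry hne i j
    rw [le_div_iff₀ (by positivity)] at h1
    have h2 : |pooledCov x y i j| ≤ |pooledCov x y i j - Sig i j| + |Sig i j| := by
      simpa using abs_add_le (pooledCov x y i j - Sig i j) (Sig i j)
    have h3 := mul_le_mul_of_nonneg_left (abs_le_offDiagMax Sig hij) hs.le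
    have h4 := mul_le_mul_of_nonneg_right h2 hs.le
    linarith

end GoodEvent

/-! ### Thresholding, small samples and the conclusion. -/

lemma support_hardThreshold {p : ℕ} {b β : Fin p → ℝ} {z : ℝ} (hz : 0 < z)
    (h : ∀ j, |b j - β j| < z) (hβ : ∀ j ∈ Function.support β, 2 * z < |β j|) :
    Function.support (hardThreshold z b) = Function.support β := by
  ext j
  have h1 := h j
  by_cases hj : β j = 0
  · rw [hj, sub_zero] at h1
    simp [hardThreshold, hj, not_le.2 h1]
  · have h2 := hβ j hj
    have h3 := abs_sub_abs_le_abs_sub (β j) (b j)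
    rw [abs_sub_comm] at h3
    have h4 : z ≤ |b j| := by linarith
    have h5 : b j ≠ 0 := abs_pos.1 (hz.trans_le h4)
    simp [hardThreshold, hj, h4, h5]

/-- By exp(x) ≥ 1 + x the sum is at least K − N/16 ≥ 7K/8. Hence the claimed probability is
nonpositive when N ≤ 2K, and otherwise N ≤ 2(N − K). -/
lemma half_le_sum_exp {m N : ℕ} {π : Fin (m + 1) → ℝ} (hsum : ∑ k, π k = 1)
    (hN : (N : ℝ) ≤ 2 * ((m : ℝ) + 1)) : 1 / 2 ≤ ∑ k, Real.exp (-((N : ℝ) * π k / 16)) := by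
  have h1 : ∑ k, (-((N : ℝ) * π k / 16) + 1) ≤ ∑ k, Real.exp (-((N : ℝ) * π k / 16)) :=
    Finset.sum_le_sum fun k _ => Real.add_one_le_exp _
  rw [Finset.sum_add_distrib, Finset.sum_neg_distrib, ← Finset.sum_div, ← Finset.mul_sum, hsum]
    at h1
  simp at h1
  have := Nat.cast_nonneg (α := ℝ) m
  linarith

end GroupLDA
/-- Here `K = m + 1 ≥ 2` is the number of classes, the tuning parameter is `λ_t` with
`t = 4 log(p ∨ N)`, and `‖·‖` on `Fin p → ℝ` is the maximum norm. -/
theorem theorem1 :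
    ∃ C₀ C₁ C₂ C₃ : ℝ, 0 < C₀ ∧ 0 < C₁ ∧ C₂ = 4 + √C₁ / 8 ∧ 0 < C₃ ∧
      ∀ (Ω : Type*) [MeasurableSpace Ω] (P : Measure Ω) [IsProbabilityMeasure P]
        (m p N : ℕ) (π : Fin (m + 1) → ℝ) (μ : Fin (m + 1) → EuclideanSpace ℝ (Fin p))
        (Sig : Matrix (Fin p) (Fin p) ℝ)
        (X : Fin N → Ω → EuclideanSpace ℝ (Fin p)) (Y : Fin N → Ω → Fin (m + 1)),
        1 ≤ m → 1 ≤ p → m + 1 < N → (∀ k, 0 < π k) → Sig.PosDef →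
        GroupLDA.IsSample P π μ Sig X Y →
        128 * (GroupLDA.sparsity μ Sig : ℝ) * GroupLDA.offDiagMax Sig ≤ GroupLDA.diagMin Sig →
        ((m : ℝ) + 1) + C₃ * (GroupLDA.diagMax Sig / GroupLDA.diagMin Sig) ^ 2
            * (GroupLDA.sparsity μ Sig : ℝ) ^ 2 * Real.log (max (p : ℝ) (N : ℝ)) ≤ (N : ℝ) →
        ∃ E : Set Ω, MeasurableSet E ∧
          1 - 2 * (∑ k, Real.exp (-((N : ℝ) * π k / 16))) - 2 / max (p : ℝ) (N : ℝ) ≤ P.real E ∧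
          ∀ ω ∈ E,
            (∃ B, GroupLDA.IsEstimate (fun i => X i ω) (fun i => Y i ω)
              (fun _ => GroupLDA.tuning C₀ π μ Sig N (4 * Real.log (max (p : ℝ) (N : ℝ)))) B) ∧
            ∀ B, GroupLDA.IsEstimate (fun i => X i ω) (fun i => Y i ω)
              (fun _ => GroupLDA.tuning C₀ π μ Sig N (4 * Real.log (max (p : ℝ) (N : ℝ)))) B →
              (∀ k, ‖B k - GroupLDA.bayesDir μ Sig k‖ ≤
                GroupLDA.errorLevel C₀ C₂ π μ Sig N) ∧
              ((∀ k, ∀ j ∈ Function.support (GroupLDA.bayesDir μ Sig k),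
                  2 * GroupLDA.errorLevel C₀ C₂ π μ Sig N < |GroupLDA.bayesDir μ Sig k j|) →
                ∀ k, Function.support (GroupLDA.hardThreshold
                    (GroupLDA.errorLevel C₀ C₂ π μ Sig N) (B k)) =
                  Function.support (GroupLDA.bayesDir μ Sig k)) := by
  refine ⟨14, 1, 4 + √1 / 8, 1280 ^ 2, by norm_num, by norm_num, rfl, by norm_num, ?_⟩
  intro Ω _ P _ m p N π μ Sig X Y hm hp hN hπ hS h hoff hsize
  have hN0 : 0 < N := by omega
  have hsum := GroupLDA.sum_label_law h hN0
  have hM3 : (3 : ℝ) ≤ max (p : ℝ) (N : ℝ) :=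
    le_max_of_le_right (by exact_mod_cast (by omega : 3 ≤ N))
  rcases le_or_gt (N : ℝ) (2 * ((m : ℝ) + 1)) with hK | hK
  · refine ⟨∅, MeasurableSet.empty, ?_, by simp⟩
    have h1 := GroupLDA.half_le_sum_exp hsum hK
    have h2 : 0 ≤ 2 / max (p : ℝ) (N : ℝ) := by positivity
    rw [measureReal_empty]
    linarith
  have hbad := GroupLDA.not_good_le h hπ hS hN hm
  set bad := {ω | ¬ ((∀ k, N * π k / 2 ≤ GroupLDA.classCount (fun i => Y i ω) k) ∧
    GroupLDA.Accurate μ Sig (Real.log (max (p : ℝ) (N : ℝ))) (fun i => X i ω)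
      fun i => Y i ω)} with hbad_def
  -- The complement of a measurable hull is measurable and avoids the bad set, at no cost in
  -- probability.
  refine ⟨(toMeasurable P bad)ᶜ, (measurableSet_toMeasurable P bad).compl, ?_, fun ω hω => ?_⟩
  · have h1 : P.real (toMeasurable P bad) = P.real bad := by
      rw [measureReal_def, measure_toMeasurable, measureReal_def]
    have h2 : 0 ≤ ∑ k, Real.exp (-((N : ℝ) * π k / 16)) :=
      Finset.sum_nonneg fun k _ => (Real.exp_pos _).le
    rw [probReal_compl_eq_one_sub (measurableSet_toMeasurable P bad), h1]
    linarith
  have hgood : ω ∉ bad := fun hb => hω (subset_toMeasurable P bad hb)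
  simp only [hbad_def, Set.mem_ofPred_eq, not_not] at hgood
  have hL : 0 < Real.log (max (p : ℝ) (N : ℝ)) := Real.log_pos (by linarith)
  obtain ⟨hex, hall⟩ := GroupLDA.estimate_of_good hS hπ hsum hm hp hL (by linarith) hN0 hgood.1
    hgood.2 hoff hsize
  refine ⟨hex, fun B hB => ?_⟩
  have ha := GroupLDA.diagMin_pos hS hp
  have hl : 0 < GroupLDA.tuning 14 π μ Sig N (4 * Real.log (max (p : ℝ) (N : ℝ))) :=
    GroupLDA.tuning_pos hS hπ hsum hm hp hL (by linarith)
  -- C₁ = 1 gives C₂ = 4 + 1/8, strictly above the 4 of the deterministic bound. Strictness matters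
  -- because thresholding keeps entries of modulus exactly ζ.
  have hlt : 4 * GroupLDA.tuning 14 π μ Sig N (4 * Real.log (max (p : ℝ) (N : ℝ)))
      / GroupLDA.diagMin Sig < GroupLDA.errorLevel 14 (4 + √1 / 8) π μ Sig N := by
    rw [GroupLDA.errorLevel_eq _ _ ha, ← GroupLDA.tuning_eq, Real.sqrt_one]
    gcongr
    norm_num
  have hz : 0 < GroupLDA.errorLevel 14 (4 + √1 / 8) π μ Sig N := lt_trans (by positivity) hlt
  have hcoord (k : Fin m) (j : Fin p) : |B k j - GroupLDA.bayesDir μ Sig k j|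
      < GroupLDA.errorLevel 14 (4 + √1 / 8) π μ Sig N :=
    ((PiLp.norm_apply_le (GroupLDA.group (B - GroupLDA.bayesDir μ Sig) j) k).trans
      (hall B hB j)).trans_lt hlt
  exact ⟨fun k => (pi_norm_le_iff_of_nonneg hz.le).2 fun j => (hcoord k j).le,
    fun hβ k => GroupLDA.support_hardThreshold hz (hcoord k) (hβ k)⟩
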